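/- Consider $n$ asynchronous deterministic processes $p_1,\dots,p_n$ (with distinct identifiers) that communicate through shared memory. In one-shot $k$-set agreement each process may invoke $\textsc{Propose}(v)$, $v\in D$, at most once ($D$ is an arbitrary set), and in every finite or infinite execution (i) every output is the input of some invocation (validity) and (ii) at most $k$ different values are output ($k$-agreement). An algorithm is $m$-obstruction-free if in every infinite execution in which at most $m$ processes take infinitely many steps, every correct process (one that takes infinitely many steps or is idle from some point on) completes its $\textsc{Propose}$ operation if it has invoked it. Let $1\le m\le k<n$. Then: (a) The following algorithm, which uses one atomic multi-writer snapshot object $A$ with $r=n+2m-k$ components, indexed $0,\dots,r-1$ and each initially $\bot$, is $m$-obstruction-free and solves one-shot $k$-set agreement among $n$ processes. To perform $\textsc{Propose}(v)$, the process with identifier $id$ sets $\mathit{pref}\leftarrow v$, $i\leftarrow 0$ and repeats the following loop. It updates the $i$th component of $A$ with the pair $(\mathit{pref},id)$ and then takes a scan $s$ of $A$. If $s$ contains no $\bot$ and $|\{s[j]:0\le j<r\}|\le m$, it outputs the value in $s[j_1]$ and halts, where $j_1=\min\{j_1:\exists j_2>j_1,\ s[j_1]=s[j_2]\}$. Otherwise,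 if $s[j]\notin\{\bot,(\mathit{pref},id)\}$ for all $j\ne i$, some two components of $s$ are equal, and the value $w$ in $s[j_1]$ (with $j_1$ as above) differs from $\mathit{pref}$, it sets $\mathit{pref}\leftarrow w$ and leaves $i$ unchanged; in all other cases it keeps $\mathit{pref}$ and sets $i\leftarrow(i+1)\bmod r$. (b) There is an $m$-obstruction-free algorithm that solves one-shot $k$-set agreement among $n$ processes and whose shared memory consists of $\min(n+2m-k,\,n)$ atomic multi-writer multi-reader read/write registers. -/

import Mathlib

universe u

namespace SetAgreement

/-- A deterministic atomic shared object: its states, its operations, the type of the response of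
each operation, and the effect of applying an operation (new state and response). -/
structure SharedObject where
  State : Type u
  Op : Type u
  Ret : Op → Type u
  apply : (o : Op) → State → State × Ret o

/-- Operations on an array of `R` multi-writer multi-reader registers holding values in `V`. -/
inductive RegisterOp (R : ℕ) (V : Type u) : Type u where
  | read (i : Fin R)
  | write (i : Fin R) (v : V)

/-- A shared memory consisting of exactly `R` atomic multi-writer multi-reader registers. -/
def registers (R : ℕ) (V : Type u) : SharedObject.{u} where
  State := Fin R → V
  Op := RegisterOp R V
  Ret
    | .read _ => V
    | .write _ _ => PUnit
  apply
    | .read i => fun mem => (mem, mem i)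
    | .write i v => fun mem => (Function.update mem i v, PUnit.unit)

/-- Operations on a multi-writer snapshot object with `r` components. -/
inductive SnapshotOp (r : ℕ) (V : Type u) : Type u where
  | update (i : Fin r) (v : V)
  | scan

/-- An atomic multi-writer snapshot object with `r` components. -/
def snapshot (r : ℕ) (V : Type u) : SharedObject.{u} where
  State := Fin r → V
  Op := SnapshotOp r V
  Ret
    | .update _ _ => PUnit
    | .scan => Fin r → V
  apply
    | .update i v => fun mem => (Function.update mem i v, PUnit.unit)
    | .scan => fun mem => (mem, mem)

/-- The next step of an active process: one atomic operation on the shared memory (the new local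
state depends on the response), a local computation, or the response of its `Propose`. -/
inductive Action (M : SharedObject.{u}) (D Local : Type u) : Type u where
  | access (o : M.Op) (cont : M.Ret o → Local)
  | compute (s : Local)
  | respond (v : D)

/-- A deterministic algorithm for `n` processes with a `Propose` operation whose arguments and
responses are in `D`. `start p v` is the local state of process `p` after `Propose v` is invoked
on it, and `next p s` is the unique next step of `p` when it is active in local state `s`. -/
structure Algorithm (M : SharedObject.{u}) (n : ℕ) (D : Type u) where
  Local : Type u
  init : M.State
  start : Fin n → D → Local
  next : Fin n → Local → Action M D Local

/-- Status of a process in the one-shot problem: `Propose` not yet invoked, `Propose` in progress,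
or `Propose` completed with an output. The process is idle in the first and the third case. -/
inductive Status (D Local : Type u) : Type u where
  | ready
  | active (s : Local)
  | done (v : D)

/-- Steps as seen in an execution, each labelled with the process that takes it. -/
inductive Event (n : ℕ) (D : Type u) : Type u where
  | invoke (p : Fin n) (v : D)
  | internal (p : Fin n)
  | respond (p : Fin n) (v : D)

/-- The process that takes a step. -/
def Event.proc {n : ℕ} {D : Type u} : Event n D → Fin n
  | .invoke p _ => p
  | .internal p => p
  | .respond p _ => p

namespace Algorithm

variable {M : SharedObject.{u}} {n : ℕ} {D : Type u}

/-- A configuration: the state of the shared memory and the status of each process. -/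
structure Config (A : Algorithm M n D) where
  mem : M.State
  status : Fin n → Status D A.Local

/-- The initial configuration. -/
def initial (A : Algorithm M n D) : A.Config where
  mem := A.init
  status := fun _ => .ready

/-- One step of the system. Every process is invoked at most once. -/
inductive Step (A : Algorithm M n D) : A.Config → Event n D → A.Config → Prop where
  | invoke (c : A.Config) (p : Fin n) (v : D) (h : c.status p = .ready) :
      Step A c (.invoke p v) ⟨c.mem, Function.update c.status p (.active (A.start p v))⟩
  | access (c : A.Config) (p : Fin n) (s : A.Local) (o : M.Op) (cont : M.Ret o → A.Local)
      (h : c.status p = .active s) (hs : A.next p s = .access o cont) :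
      Step A c (.internal p)
        ⟨(M.apply o c.mem).1,
          Function.update c.status p (.active (cont (M.apply o c.mem).2))⟩
  | compute (c : A.Config) (p : Fin n) (s s' : A.Local)
      (h : c.status p = .active s) (hs : A.next p s = .compute s') :
      Step A c (.internal p) ⟨c.mem, Function.update c.status p (.active s')⟩
  | respond (c : A.Config) (p : Fin n) (s : A.Local) (v : D)
      (h : c.status p = .active s) (hs : A.next p s = .respond v) :
      Step A c (.respond p v) ⟨c.mem, Function.update c.status p (.done v)⟩

/-- A finite or infinite execution from the initial configuration. Only the events at times
`t < length` and the configurations at times `t ≤ length` are meaningful. -/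
structure Execution (A : Algorithm M n D) where
  length : ℕ∞
  config : ℕ → A.Config
  event : ℕ → Event n D
  start_eq : config 0 = A.initial
  step : ∀ t : ℕ, (t : ℕ∞) < length → A.Step (config t) (event t) (config (t + 1))

namespace Execution

variable {A : Algorithm M n D}

/-- The set of values used as an argument of `Propose`. -/
def inputs (α : A.Execution) : Set D :=
  {v | ∃ t : ℕ, (t : ℕ∞) < α.length ∧ ∃ p, α.event t = .invoke p v}

/-- The set of values that are a response of `Propose`. -/
def outputs (α : A.Execution) : Set D :=
  {v | ∃ t : ℕ, (t : ℕ∞) < α.length ∧ ∃ p, α.event t = .respond p v}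

/-- Process `p` takes infinitely many steps. -/
def InfinitelyManySteps (α : A.Execution) (p : Fin n) : Prop :=
  {t : ℕ | (t : ℕ∞) < α.length ∧ (α.event t).proc = p}.Infinite

/-- In an infinite execution, a process is correct if it takes infinitely many steps or is idle
from some point on. -/
def Correct (α : A.Execution) (p : Fin n) : Prop :=
  α.InfinitelyManySteps p ∨ ∃ T : ℕ, ∀ t ≥ T, ∀ s, (α.config t).status p ≠ .active s

/-- Every `Propose` invoked on `p` is followed by a response. -/
def Completes (α : A.Execution) (p : Fin n) : Prop :=
  ∀ t : ℕ, (t : ℕ∞) < α.length → ∀ v, α.event t = .invoke p v →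
    ∃ t' : ℕ, t < t' ∧ (t' : ℕ∞) < α.length ∧ ∃ w, α.event t' = .respond p w

end Execution

/-- The algorithm satisfies validity and `k`-agreement in every execution. -/
def SolvesSetAgreement (A : Algorithm M n D) (k : ℕ) : Prop :=
  ∀ α : A.Execution, α.outputs ⊆ α.inputs ∧ α.outputs.encard ≤ k

/-- In every infinite execution in which at most `m` processes take infinitely many steps, every
correct process completes its operation. -/
def ObstructionFree (A : Algorithm M n D) (m : ℕ) : Prop :=
  ∀ α : A.Execution, α.length = ⊤ →
    {p : Fin n | α.InfinitelyManySteps p}.encard ≤ m → ∀ p, α.Correct p → α.Completes p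

end Algorithm

/-! ### The two-copies algorithm on a snapshot object -/

/-- Local states of the two-copies algorithm: about to update component `i` with `pref` and the
process's identifier, about to scan, or about to output `v`. -/
inductive TwoCopiesLocal (r : ℕ) (D : Type u) : Type u where
  | update (pref : D) (i : Fin r)
  | scan (pref : D) (i : Fin r)
  | output (v : D)

open scoped Classical in
/-- The value in `s[j₁]`, where `j₁` is the least index such that `s[j₁] = s[j₂]` for some
`j₂ > j₁`. It is `none` if no entry is repeated (or if `s[j₁]` is the initial value `⊥ = none`). -/
noncomputable def repeatedValue {n r : ℕ} {D : Type u} (s : Fin r → Option (D × Fin n)) :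
    Option D :=
  if h : ∃ j₁ : Fin r, ∃ j₂ : Fin r, j₁ < j₂ ∧ s j₁ = s j₂ then
    (s (Fin.find (fun j₁ => ∃ j₂ : Fin r, j₁ < j₂ ∧ s j₁ = s j₂) h)).map Prod.fst
  else none

open scoped Classical in
/-- The local computation of process `id` after a scan has returned `s`. If `s` has no `⊥` and at
most `m` different pairs, output the first repeated value. Otherwise, if the pair `(pref, id)` and
`⊥` appear nowhere outside component `i` and the first repeated value differs from `pref`, adopt
that value and keep `i`. In all other cases keep `pref` and advance `i` cyclically. -/
noncomputable def afterScan {n r : ℕ} {D : Type u} (m : ℕ) (hr : 0 < r) (id : Fin n)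
    (pref : D) (i : Fin r) (s : Fin r → Option (D × Fin n)) : TwoCopiesLocal r D :=
  match repeatedValue s with
  | some w =>
    if (Set.range s).encard ≤ m ∧ ∀ j, s j ≠ none then .output w
    else if (∀ j, j ≠ i → s j ≠ none ∧ s j ≠ some (pref, id)) ∧ w ≠ pref then .update w i
    else .update pref ⟨(i + 1) % r, Nat.mod_lt _ hr⟩
  | none => .update pref ⟨(i + 1) % r, Nat.mod_lt _ hr⟩

/-- The two-copies algorithm for `n` processes with parameter `m`, on an atomic snapshot object
with `r` components, each initially `⊥`. -/
noncomputable def twoCopies (n m r : ℕ) (hr : 0 < r) (D : Type u) :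
    Algorithm (snapshot r (Option (D × Fin n))) n D where
  Local := TwoCopiesLocal r D
  init := fun _ => none
  start := fun _ v => .update v ⟨0, hr⟩
  next := fun id l => match l with
    | .update pref i => .access (.update i (some (pref, id))) fun _ => .scan pref i
    | .scan pref i => .access .scan fun s => afterScan m hr id pref i s
    | .output v => .respond v

theorem components_pos {n k : ℕ} (m : ℕ) (hkn : k < n) : 0 < n + 2 * m - k := by
  omega

end SetAgreement

/-! Agreement in (a). All pairs of one process in memory are equal at any time (`OwnPairs`), because
a process changes its preference only when its old pair stands nowhere except in the component it
overwrites next. Take the scan `s₀` by which the number of decided processes first exceeds `k - m`,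
let `H` be the set of processes decided after it, and `V` the set of values in `s₀`; since `s₀`
allowed a decision, `V` has at most `m` elements. Earlier deciders contribute at most `k - m`
values, so it suffices that all later decisions lie in `V`. The invariant `Locked` says that the
pairs of `H` are leftovers from `s₀` and that no process outside `H` has a value outside `V` in two
components. Hence a repeated value always lies in `V`. Moreover some pair is always repeated:
distinct pairs would fill at most `m` components with owners in `H` and at most `n - |H|` others,
and `|H| ≥ k - m + 1` makes the sum less than `r = n + 2m - k`. So a process that has written one
copy of a value outside `V` must adopt a value of `V` at its next scan instead of writing a second
copy.

Termination in (a). Suppose that at least one and at most `m` processes take infinitely many steps.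
Once the others have stopped, some component is never written again; otherwise memory would hold
only pairs of live processes, at most `m` of them, and the next scan would decide. Indices advance
cyclically and cannot pass that component, so every live process ends up at a fixed index, and each
of its scans makes it adopt a new value. Eventually a pair of a live process stands only at the
index of its owner, so repeated pairs belong to stopped processes and lie in components that no
longer change. The first repeated value is therefore constant and cannot be adopted twice in
succession.

For (b), snapshots are implemented from as many registers as there are components. Written values
carry unique tags, so a register never returns to earlier contents. A scan repairs a local view
until one complete pass agrees with it, and takes effect at the first read of that pass. This
preserves safety in all executions, and preserves `m`-obstruction-freedom because scans can fail
forever only while others write. If `n + 2m - k ≤ n`, this is applied to the two-copies algorithm.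
Otherwise it is applied to `converge`, a round-based voting algorithm with one component per
process, which even achieves `m`-agreement. -/

namespace SetAgreement

/-! ### Executions as infinite traces with stuttering -/

namespace Algorithm

variable {M : SharedObject.{u}} {n : ℕ} {D : Type u} {A : Algorithm M n D}

/-- A run of the algorithm indexed by all natural numbers, in which stuttering is allowed. -/
structure Trace (A : Algorithm M n D) where
  config : ℕ → A.Config
  event : ℕ → Option (Event n D)
  start_eq : config 0 = A.initial
  step_some : ∀ t e, event t = some e → A.Step (config t) e (config (t + 1))
  step_none : ∀ t, event t = none → config (t + 1) = config t

theorem Step.status_of_ne {c c' : A.Config} {e : Event n D} (h : A.Step c e c') {q : Fin n}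
    (hq : q ≠ e.proc) : c'.status q = c.status q := by
  cases h <;> exact Function.update_of_ne hq _ _

theorem Step.proc_not_done {c c' : A.Config} {e : Event n D} (h : A.Step c e c') (v : D) :
    c.status e.proc ≠ .done v := by
  cases h <;> simp_all [Event.proc]

namespace Trace

variable (τ : A.Trace)

/-- The status of process `p` at time `t`. -/
def status (t : ℕ) (p : Fin n) : Status D A.Local := (τ.config t).status p

/-- The shared memory at time `t`. -/
def mem (t : ℕ) : M.State := (τ.config t).mem

/-- Process `p` takes a step at time `t`. -/
def Moves (t : ℕ) (p : Fin n) : Prop := ∃ e, τ.event t = some e ∧ e.proc = p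

/-- Process `p` takes infinitely many steps. -/
def Live (p : Fin n) : Prop := {t | τ.Moves t p}.Infinite

/-- The set of values used as an argument of `Propose`. -/
def inputs : Set D := {v | ∃ t p, τ.event t = some (.invoke p v)}

/-- The set of values that are a response of `Propose`. -/
def outputs : Set D := {v | ∃ t p, τ.event t = some (.respond p v)}

variable {τ}

theorem status_zero (p : Fin n) : τ.status 0 p = .ready := by
  simp [status, τ.start_eq, initial]

theorem mem_zero : τ.mem 0 = A.init := by
  simp [mem, τ.start_eq, initial]

theorem status_succ_of_not_moves {t : ℕ} {p : Fin n} (h : ¬ τ.Moves t p) :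
    τ.status (t + 1) p = τ.status t p := by
  rcases he : τ.event t with _ | e
  · simp [status, τ.step_none t he]
  · exact (τ.step_some t e he).status_of_ne fun hq => h ⟨e, he, hq.symm⟩

theorem status_eq_of_not_moves {a b : ℕ} (hab : a ≤ b) {p : Fin n}
    (h : ∀ t, a ≤ t → t < b → ¬ τ.Moves t p) : τ.status b p = τ.status a p := by
  induction b, hab using Nat.le_induction with
  | base => rfl
  | succ b hb ih =>
    rw [status_succ_of_not_moves (h b hb b.lt_succ_self)]
    exact ih fun t h₁ h₂ => h t h₁ (h₂.trans b.lt_succ_self)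

theorem Live.exists_ge {p : Fin n} (h : τ.Live p) (a : ℕ) : ∃ t ≥ a, τ.Moves t p := by
  obtain ⟨t, ht, hat⟩ := h.exists_gt a
  exact ⟨t, hat.le, ht⟩

/-- The next step of a live process is taken from its current status. -/
theorem Live.next_move {p : Fin n} (h : τ.Live p) (a : ℕ) :
    ∃ t ≥ a, τ.Moves t p ∧ τ.status t p = τ.status a p := by
  classical
  have hex := h.exists_ge a
  refine ⟨Nat.find hex, (Nat.find_spec hex).1, (Nat.find_spec hex).2, ?_⟩
  exact status_eq_of_not_moves (Nat.find_spec hex).1 fun t h₁ h₂ hm => Nat.find_min hex h₂ ⟨h₁, hm⟩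

theorem exists_forall_not_moves {p : Fin n} (h : ¬ τ.Live p) : ∃ T, ∀ t ≥ T, ¬ τ.Moves t p := by
  rw [Live, Set.not_infinite] at h
  obtain ⟨T, hT⟩ := h.bddAbove
  exact ⟨T + 1, fun t ht hm => absurd (hT hm) (by omega)⟩

/-- From some time on, only live processes take steps. -/
theorem exists_forall_live (τ : A.Trace) : ∃ T, ∀ t ≥ T, ∀ p, τ.Moves t p → τ.Live p := by
  classical
  have : ∀ p, ∃ T, ∀ t ≥ T, τ.Moves t p → τ.Live p := fun p => by
    by_cases h : τ.Live p
    · exact ⟨0, fun _ _ _ => h⟩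
    · obtain ⟨T, hT⟩ := exists_forall_not_moves h
      exact ⟨T, fun t ht hm => absurd hm (hT t ht)⟩
  choose T hT using this
  exact ⟨Finset.univ.sup T, fun t ht p =>
    hT p t ((Finset.le_sup (Finset.mem_univ p)).trans ht)⟩

/-- A quantity that decreases at each step of `p` and never increases bounds the number of steps. -/
theorem not_live_of_rank {p : Fin n} (f : ℕ → ℕ) (T : ℕ) (hle : ∀ t ≥ T, f (t + 1) ≤ f t)
    (hlt : ∀ t ≥ T, τ.Moves t p → f (t + 1) < f t) : ¬ τ.Live p := by
  intro hp
  have hanti : ∀ a ≥ T, ∀ b ≥ a, f b ≤ f a := fun a ha b hb => by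
    induction b, hb using Nat.le_induction with
    | base => exact le_rfl
    | succ b hb ih => exact (hle b (ha.trans hb)).trans ih
  have : ∀ N, ∀ t ≥ T, f t ≤ N → False := by
    intro N
    induction N with
    | zero =>
      intro t ht h0
      obtain ⟨t', h1, h2⟩ := hp.exists_ge t
      have := hlt t' (ht.trans h1) h2
      have := hanti t ht t' h1
      omega
    | succ N ih =>
      intro t ht h0
      obtain ⟨t', h1, h2⟩ := hp.exists_ge t
      have := hlt t' (ht.trans h1) h2
      have := hanti t ht t' h1
      exact ih (t' + 1) (by omega) (by omega)
  exact this (f T) T le_rfl le_rfl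

theorem not_moves_of_done {t : ℕ} {p : Fin n} {v : D} (h : τ.status t p = .done v) :
    ¬ τ.Moves t p := by
  rintro ⟨e, he, rfl⟩
  exact (τ.step_some t e he).proc_not_done v h

theorem done_mono {a b : ℕ} (hab : a ≤ b) {p : Fin n} {v : D} (h : τ.status a p = .done v) :
    τ.status b p = .done v := by
  induction b, hab using Nat.le_induction with
  | base => exact h
  | succ b hb ih => rw [status_succ_of_not_moves (not_moves_of_done ih), ih]

theorem Live.not_done {p : Fin n} (h : τ.Live p) (t : ℕ) (v : D) : τ.status t p ≠ .done v := by
  intro hd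
  obtain ⟨t', h1, h2⟩ := h.exists_ge t
  exact not_moves_of_done (done_mono h1 hd) h2

end Trace

/-- Validity and `k`-agreement in every trace. -/
def TraceSolves (A : Algorithm M n D) (k : ℕ) : Prop :=
  ∀ τ : A.Trace, τ.outputs ⊆ τ.inputs ∧ τ.outputs.encard ≤ k

/-- It is impossible that at least one and at most `m` processes take infinitely many steps. -/
def TraceTerminates (A : Algorithm M n D) (m : ℕ) : Prop :=
  ∀ τ : A.Trace, {p | τ.Live p}.encard ≤ m → ∀ p, ¬ τ.Live p

open scoped Classical in
/-- Prolong an execution by stuttering. -/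
noncomputable def Execution.toTrace (α : A.Execution) : A.Trace where
  -- Beyond `length` the fields of an execution are arbitrary, so the last meaningful configuration
  -- is repeated.
  config t := α.config (if (t : ℕ∞) ≤ α.length then t else α.length.toNat)
  event t := if (t : ℕ∞) < α.length then some (α.event t) else none
  start_eq := by simp [α.start_eq]
  step_some t e he := by
    split_ifs at he with h
    have h' : ((t + 1 : ℕ) : ℕ∞) ≤ α.length := by
      rw [Nat.cast_add, Nat.cast_one]; exact Order.add_one_le_of_lt h
    rw [if_pos h.le, if_pos h']
    cases he
    exact α.step t h
  step_none t he := by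
    split_ifs at he with h
    have h' : ¬ ((t + 1 : ℕ) : ℕ∞) ≤ α.length := fun hle =>
      h (lt_of_lt_of_le (by exact_mod_cast t.lt_succ_self) hle)
    rw [if_neg h']
    split_ifs with h2
    · have : α.length = t := le_antisymm (not_lt.1 h) h2
      simp [this]
    · rfl

theorem Execution.toTrace_event_eq_some {α : A.Execution} {t : ℕ} {e : Event n D} :
    α.toTrace.event t = some e ↔ (t : ℕ∞) < α.length ∧ α.event t = e := by
  simp [Execution.toTrace]

theorem TraceSolves.solvesSetAgreement {k : ℕ} (h : A.TraceSolves k) : A.SolvesSetAgreement k := by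
  intro α
  have hin : α.toTrace.inputs = α.inputs := by
    ext v; simp [Trace.inputs, Execution.inputs, Execution.toTrace_event_eq_some]
  have hout : α.toTrace.outputs = α.outputs := by
    ext v; simp [Trace.outputs, Execution.outputs, Execution.toTrace_event_eq_some]
  rw [← hin, ← hout]
  exact h _

/-- An operation without a response keeps its process active forever after the invocation. A correct
process in this situation cannot be idle from some point on, so it takes infinitely many steps,
which is excluded. -/
theorem TraceTerminates.obstructionFree {m : ℕ} (h : A.TraceTerminates m) :
    A.ObstructionFree m := by
  intro α hα hcard p hp t ht v hv
  have hlive : ∀ q, α.toTrace.Live q ↔ α.InfinitelyManySteps q := fun q => by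
    simp [Trace.Live, Trace.Moves, Execution.InfinitelyManySteps,
      Execution.toTrace_event_eq_some, hα]
  by_contra hno
  push Not at hno
  have hact : ∀ t' > t, ∃ s, (α.config t').status p = .active s := by
    intro t' ht'
    induction t', ht' using Nat.le_induction with
    | base =>
      have hs := α.step t ht
      rw [hv] at hs
      generalize α.config t = c, α.config (t + 1) = c' at hs
      cases hs
      exact ⟨_, Function.update_self _ _ _⟩
    | succ t' ht' ih =>
      obtain ⟨s, hs⟩ := ih
      have hstep := α.step t' (by simp [hα])
      have hne := hno t' ht' (by simp [hα])
      generalize α.config t' = c, α.config (t' + 1) = c', α.event t' = e at hs hstep hne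
      by_cases hpe : p = e.proc
      · cases hstep with
        | invoke q v h => cases hpe; simp_all [Event.proc]
        | access q => cases hpe; exact ⟨_, Function.update_self _ _ _⟩
        | compute q => cases hpe; exact ⟨_, Function.update_self _ _ _⟩
        | respond q s w => cases hpe; exact absurd rfl (hne w)
      · exact ⟨s, by rw [hstep.status_of_ne hpe, hs]⟩
  rcases hp with hp | ⟨T, hT⟩
  · exact h α.toTrace (by simpa only [hlive] using hcard) p ((hlive p).2 hp)
  · obtain ⟨s, hs⟩ := hact (max T (t + 1)) (by omega)
    exact hT _ (le_max_left _ _) s hs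

end Algorithm

open Algorithm

/-! ### The two-copies algorithm: validity and agreement -/

section TwoCopies

variable {n m r : ℕ} {hr : 0 < r} {D : Type u}

/-- The minimality of `j₁` in the last clause matters only for termination, where it shows that
different scans find the same repeated value. -/
theorem exists_of_repeatedValue_eq_some {s : Fin r → Option (D × Fin n)} {w : D}
    (h : repeatedValue s = some w) :
    ∃ j₁ j₂ q, j₁ < j₂ ∧ s j₁ = some (w, q) ∧ s j₂ = some (w, q) ∧
      ∀ j < j₁, ∀ j', j < j' → s j ≠ s j' := by
  classical
  unfold repeatedValue at h
  split_ifs at h with hex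
  obtain ⟨j₂, hlt, heq⟩ := Fin.find_spec hex
  rw [Option.map_eq_some_iff] at h
  obtain ⟨⟨w', q⟩, hs, rfl⟩ := h
  exact ⟨_, j₂, q, hlt, hs, heq ▸ hs, fun j hj j' hjj' he => Fin.find_min hex hj ⟨j', hjj', he⟩⟩

theorem exists_repeatedValue {s : Fin r → Option (D × Fin n)} (hs : ∀ j, s j ≠ none)
    (hinj : ¬ Function.Injective s) : ∃ w, repeatedValue s = some w := by
  classical
  have hex : ∃ j₁ : Fin r, ∃ j₂ : Fin r, j₁ < j₂ ∧ s j₁ = s j₂ := by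
    simp only [Function.Injective, not_forall] at hinj
    obtain ⟨a, b, hab, hne⟩ := hinj
    rcases lt_or_gt_of_ne hne with h | h
    · exact ⟨a, b, h, hab⟩
    · exact ⟨b, a, h, hab.symm⟩
  unfold repeatedValue
  rw [dif_pos hex]
  obtain ⟨x, hx⟩ := Option.ne_none_iff_exists'.1 (hs (Fin.find _ hex))
  exact ⟨x.1, by rw [hx]; rfl⟩

theorem not_injective_of_encard_range_le {s : Fin r → Option (D × Fin n)} (hmr : m < r)
    (h : (Set.range s).encard ≤ m) : ¬ Function.Injective s := by
  intro hinj
  rw [← Set.image_univ, hinj.encard_image, Set.encard_univ, ENat.card_eq_coe_fintype_card,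
    Fintype.card_fin] at h
  exact absurd hmr (not_lt.2 (by exact_mod_cast h))

theorem afterScan_cases (m : ℕ) (hr : 0 < r) (p : Fin n) (pref : D) (i : Fin r)
    (s : Fin r → Option (D × Fin n)) :
    (∃ w, repeatedValue s = some w ∧ ((Set.range s).encard ≤ m ∧ ∀ j, s j ≠ none) ∧
      afterScan m hr p pref i s = .output w) ∨
    (∃ w, repeatedValue s = some w ∧
      ((∀ j, j ≠ i → s j ≠ none ∧ s j ≠ some (pref, p)) ∧ w ≠ pref) ∧
      afterScan m hr p pref i s = .update w i) ∨
    ((∀ w, repeatedValue s = some w → ¬ ((Set.range s).encard ≤ m ∧ ∀ j, s j ≠ none) ∧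
      ¬ ((∀ j, j ≠ i → s j ≠ none ∧ s j ≠ some (pref, p)) ∧ w ≠ pref)) ∧
      afterScan m hr p pref i s = .update pref ⟨(i + 1) % r, Nat.mod_lt _ hr⟩) := by
  unfold afterScan
  rcases h : repeatedValue s with _ | w
  · exact .inr (.inr ⟨by simp, rfl⟩)
  · by_cases h₁ : (Set.range s).encard ≤ m ∧ ∀ j, s j ≠ none
    · exact .inl ⟨w, rfl, h₁, if_pos h₁⟩
    · by_cases h₂ : (∀ j, j ≠ i → s j ≠ none ∧ s j ≠ some (pref, p)) ∧ w ≠ pref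
      · exact .inr (.inl ⟨w, rfl, h₂, (if_neg h₁).trans (if_pos h₂)⟩)
      · refine .inr (.inr ⟨fun w' hw' => ?_, (if_neg h₁).trans (if_neg h₂)⟩)
        cases hw'
        exact ⟨h₁, h₂⟩

/-- The steps of the two-copies algorithm, on contents of the snapshot object and statuses. -/
inductive TwoCopiesStep (m : ℕ) (hr : 0 < r) :
    (Fin r → Option (D × Fin n)) → (Fin n → Status D (TwoCopiesLocal r D)) → Event n D →
    (Fin r → Option (D × Fin n)) → (Fin n → Status D (TwoCopiesLocal r D)) → Prop where
  | invoke (s st p v) (h : st p = .ready) :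
      TwoCopiesStep m hr s st (.invoke p v) s
        (Function.update st p (.active (.update v ⟨0, hr⟩)))
  | update (s st p pref i) (h : st p = .active (.update pref i)) :
      TwoCopiesStep m hr s st (.internal p) (Function.update s i (some (pref, p)))
        (Function.update st p (.active (.scan pref i)))
  | scan (s st p pref i) (h : st p = .active (.scan pref i)) :
      TwoCopiesStep m hr s st (.internal p) s
        (Function.update st p (.active (afterScan m hr p pref i s)))
  | respond (s st p v) (h : st p = .active (.output v)) :
      TwoCopiesStep m hr s st (.respond p v) s (Function.update st p (.done v))

theorem twoCopies_step {c c' : (twoCopies n m r hr D).Config} {e : Event n D}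
    (h : (twoCopies n m r hr D).Step c e c') :
    TwoCopiesStep m hr c.mem c.status e c'.mem c'.status := by
  cases h with
  | invoke p v h => exact .invoke _ _ p v h
  | access p l o cont h hs =>
    cases l with
    | update pref i => cases hs; exact .update _ _ p pref i h
    | scan pref i => cases hs; exact .scan _ _ p pref i h
    | output v => cases hs
  | compute p l l' h hs => cases l <;> cases hs
  | respond p l v h hs =>
    cases l with
    | update pref i => cases hs
    | scan pref i => cases hs
    | output v => cases hs; exact .respond _ _ p _ h

/-- The decision of a process that is about to respond or has responded. -/
def decision : Status D (TwoCopiesLocal r D) → Option D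
  | .active (.output v) => some v
  | .done v => some v
  | _ => none

theorem TwoCopiesStep.decision_mono {s s' : Fin r → Option (D × Fin n)}
    {st st' : Fin n → Status D (TwoCopiesLocal r D)} {e : Event n D}
    (h : TwoCopiesStep m hr s st e s' st') {p : Fin n} {v : D} (hp : decision (st p) = some v) :
    decision (st' p) = some v := by
  have key : ∀ q x, (p = q → decision x = some v) →
      decision (Function.update st q x p) = some v := fun q x hx => by
    by_cases hq : p = q
    · subst hq; rw [Function.update_self]; exact hx rfl
    · rw [Function.update_of_ne hq]; exact hp
  cases h with
  | invoke q w h => exact key _ _ (by rintro rfl; rw [h] at hp; cases hp)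
  | update q pref i h => exact key _ _ (by rintro rfl; rw [h] at hp; cases hp)
  | scan q pref i h => exact key _ _ (by rintro rfl; rw [h] at hp; cases hp)
  | respond q w h => exact key _ _ (by rintro rfl; rw [h] at hp; exact hp)

/-- All pairs of `p` in memory are equal; the details depend on the status of `p`. -/
def OwnPairs (s : Fin r → Option (D × Fin n)) (p : Fin n) :
    Status D (TwoCopiesLocal r D) → Prop
  | .ready => ∀ j v, s j ≠ some (v, p)
  | .active (.update pref i) =>
      (∀ j v, s j = some (v, p) → v = pref) ∨ (∀ j v, s j = some (v, p) → j = i)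
  | .active (.scan pref _) => ∀ j v, s j = some (v, p) → v = pref
  | .active (.output _) => ∀ j v j' v', s j = some (v, p) → s j' = some (v', p) → v = v'
  | .done _ => ∀ j v j' v', s j = some (v, p) → s j' = some (v', p) → v = v'

/-- A pair in memory is determined by its owner. Both counting arguments, for agreement and for
termination, use this to bound numbers of distinct pairs by numbers of processes. -/
theorem OwnPairs.unique {s : Fin r → Option (D × Fin n)} {p : Fin n}
    {st : Status D (TwoCopiesLocal r D)} (h : OwnPairs s p st) {j j' : Fin r} {v v' : D}
    (hj : s j = some (v, p)) (hj' : s j' = some (v', p)) : v = v' := by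
  rcases st with _ | (⟨pref, i⟩ | ⟨pref, i⟩ | w) | w
  · exact absurd hj (h j v)
  · rcases h with h | h
    · rw [h j v hj, h j' v' hj']
    · have h1 := h j v hj
      have h2 := h j' v' hj'
      subst h1; subst h2
      rw [hj] at hj'; cases hj'; rfl
  · rw [h j v hj, h j' v' hj']
  · exact h _ _ _ _ hj hj'
  · exact h _ _ _ _ hj hj'

theorem OwnPairs.mono {s s' : Fin r → Option (D × Fin n)} {p : Fin n}
    {st : Status D (TwoCopiesLocal r D)} (h : OwnPairs s p st)
    (hs : ∀ j v, s' j = some (v, p) → s j = some (v, p)) : OwnPairs s' p st := by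
  rcases st with _ | (⟨pref, i⟩ | ⟨pref, i⟩ | w) | w
  · exact fun j v hj => h j v (hs j v hj)
  · exact h.imp (fun h j v hj => h j v (hs j v hj)) (fun h j v hj => h j v (hs j v hj))
  · exact fun j v hj => h j v (hs j v hj)
  · exact fun j v j' v' hj hj' => h j v j' v' (hs j v hj) (hs j' v' hj')
  · exact fun j v j' v' hj hj' => h j v j' v' (hs j v hj) (hs j' v' hj')

theorem eq_some_of_update_eq_some {s : Fin r → Option (D × Fin n)} {p q : Fin n} (hq : q ≠ p)
    {i j : Fin r} {v w : D} (h : Function.update s i (some (v, p)) j = some (w, q)) :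
    s j = some (w, q) := by
  by_cases hj : j = i
  · subst hj
    rw [Function.update_self] at h
    cases h
    exact absurd rfl hq
  · rwa [Function.update_of_ne hj] at h

/-- The delicate step is the adoption of a new value: its condition says that the old pair stands at
most in component `i`, and `i` is kept, so the next update erases the last old copy before a new one
appears. -/
theorem TwoCopiesStep.ownPairs {s s' : Fin r → Option (D × Fin n)}
    {st st' : Fin n → Status D (TwoCopiesLocal r D)} {e : Event n D}
    (h : TwoCopiesStep m hr s st e s' st') (hown : ∀ p, OwnPairs s p (st p)) (p : Fin n) :
    OwnPairs s' p (st' p) := by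
  have hp := hown p
  cases h with
  | invoke q v h =>
    by_cases hq : p = q
    · subst hq
      rw [h] at hp
      rw [Function.update_self]
      exact .inl fun j w hj => absurd hj (hp j w)
    · rwa [Function.update_of_ne hq]
  | update q pref i h =>
    by_cases hq : p = q
    · subst hq
      rw [h] at hp
      rw [Function.update_self]
      intro j v hj
      by_cases hji : j = i
      · subst hji
        rw [Function.update_self] at hj
        cases hj; rfl
      · rw [Function.update_of_ne hji] at hj
        rcases hp with hp | hp
        · exact hp j v hj
        · exact absurd (hp j v hj) hji
    · rw [Function.update_of_ne hq]
      exact hp.mono fun j v hj => eq_some_of_update_eq_some hq hj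
  | scan q pref i h =>
    by_cases hq : p = q
    · subst hq
      rw [h] at hp
      rw [Function.update_self]
      rcases afterScan_cases m hr p pref i s with ⟨w, -, -, hw⟩ | ⟨w, -, ⟨hw, -⟩, hw'⟩ | ⟨-, hw⟩
      · rw [hw]
        exact fun j v j' v' hj hj' => (hp j v hj).trans (hp j' v' hj').symm
      · rw [hw']
        refine .inr fun j v hj => ?_
        by_contra hji
        exact (hw j hji).2 (hp j v hj ▸ hj)
      · rw [hw]
        exact .inl hp
    · rwa [Function.update_of_ne hq]
  | respond q v h =>
    by_cases hq : p = q
    · subst hq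
      rw [h] at hp
      rw [Function.update_self]
      exact hp
    · rwa [Function.update_of_ne hq]

/-! ### The invariant after more than `k - m` decisions -/

/-- At most one component holds a pair of `p` whose value is outside `V`. -/
def AtMostOneOutside (V : Set D) (s : Fin r → Option (D × Fin n)) (p : Fin n) : Prop :=
  ∀ i j v w, s i = some (v, p) → v ∉ V → s j = some (w, p) → w ∉ V → i = j

/-- Constraints on pairs of `p` with values outside `V`, by status of `p`. -/
def OutsidePairs (V : Set D) (s : Fin r → Option (D × Fin n)) (p : Fin n) :
    Status D (TwoCopiesLocal r D) → Prop
  | .ready => ∀ j v, s j = some (v, p) → v ∈ V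
  | .active (.update pref _) =>
      (pref ∉ V → ∀ j v, s j = some (v, p) → v ∈ V) ∧ AtMostOneOutside V s p
  | .active (.scan _ i) => ∀ j v, s j = some (v, p) → v ∉ V → j = i
  | .active (.output w) => w ∈ V ∧ AtMostOneOutside V s p
  | .done w => w ∈ V ∧ AtMostOneOutside V s p

theorem OutsidePairs.atMostOne {V : Set D} {s : Fin r → Option (D × Fin n)} {p : Fin n}
    {st : Status D (TwoCopiesLocal r D)} (h : OutsidePairs V s p st) : AtMostOneOutside V s p := by
  rcases st with _ | (⟨pref, i⟩ | ⟨pref, i⟩ | w) | w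
  · exact fun j j' v v' hj hv => absurd (h j v hj) hv
  · exact h.2
  · exact fun j j' v v' hj hv hj' hv' => (h j v hj hv).trans (h j' v' hj' hv').symm
  · exact h.2
  · exact h.2

theorem AtMostOneOutside.mono {V : Set D} {s s' : Fin r → Option (D × Fin n)} {p : Fin n}
    (h : AtMostOneOutside V s p) (hs : ∀ j v, s' j = some (v, p) → s j = some (v, p)) :
    AtMostOneOutside V s' p :=
  fun j j' v v' hj hv hj' hv' => h j j' v v' (hs j v hj) hv (hs j' v' hj') hv'

theorem OutsidePairs.mono {V : Set D} {s s' : Fin r → Option (D × Fin n)} {p : Fin n}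
    {st : Status D (TwoCopiesLocal r D)} (h : OutsidePairs V s p st)
    (hs : ∀ j v, s' j = some (v, p) → s j = some (v, p)) : OutsidePairs V s' p st := by
  rcases st with _ | (⟨pref, i⟩ | ⟨pref, i⟩ | w) | w
  · exact fun j v hj => h j v (hs j v hj)
  · exact ⟨fun hV j v hj => h.1 hV j v (hs j v hj), h.2.mono hs⟩
  · exact fun j v hj => h j v (hs j v hj)
  · exact ⟨h.1, h.2.mono hs⟩
  · exact ⟨h.1, h.2.mono hs⟩

/-- While a process has no pair outside `V`, the restrictions on copies are vacuous. This starts the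
invariant at the deciding scan and again for processes invoked later. -/
theorem OutsidePairs.of_forall_mem {V : Set D} {s : Fin r → Option (D × Fin n)} {p : Fin n}
    {st : Status D (TwoCopiesLocal r D)} (h : ∀ j v, s j = some (v, p) → v ∈ V)
    (hst : ∀ v, decision st = some v → v ∈ V) : OutsidePairs V s p st := by
  have h1 : AtMostOneOutside V s p := fun j _ v _ hj hv => absurd (h j v hj) hv
  rcases st with _ | (⟨pref, i⟩ | ⟨pref, i⟩ | w) | w
  · exact h
  · exact ⟨fun _ => h, h1⟩
  · exact fun j v hj hv => absurd (h j v hj) hv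
  · exact ⟨hst w rfl, h1⟩
  · exact ⟨hst w rfl, h1⟩

/-- The set of values that occur in memory. -/
def memValues (s : Fin r → Option (D × Fin n)) : Set D := {v | ∃ j q, s j = some (v, q)}

theorem encard_memValues_le (s : Fin r → Option (D × Fin n)) :
    (memValues s).encard ≤ (Set.range s).encard := by
  have : some '' memValues s ⊆ (Option.map Prod.fst) '' Set.range s := by
    rintro _ ⟨v, ⟨j, q, h⟩, rfl⟩
    exact ⟨s j, ⟨j, rfl⟩, by rw [h]; rfl⟩
  rw [← (Option.some_injective D).encard_image (memValues s)]
  exact (Set.encard_le_encard this).trans (Set.encard_image_le _ _)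

/-- The situation after the processes in `H` have decided, the last of them by a scan of `s₀`. -/
structure Locked (H : Finset (Fin n)) (s₀ s : Fin r → Option (D × Fin n))
    (st : Fin n → Status D (TwoCopiesLocal r D)) : Prop where
  full : ∀ j, s j ≠ none
  decided : ∀ p ∈ H, (decision (st p)).isSome
  old : ∀ p ∈ H, ∀ j v, s j = some (v, p) → some (v, p) ∈ Set.range s₀
  outside : ∀ p ∉ H, OutsidePairs (memValues s₀) s p (st p)

/-- If all entries were distinct, at most `m` components would belong to `H`, since their pairs
already occur in `s₀`, and at most one to each of the other `n - H.card` processes, whose pairs are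
all equal. This is fewer than `r` components. -/
theorem Locked.not_injective {H : Finset (Fin n)} {s₀ s : Fin r → Option (D × Fin n)}
    {st : Fin n → Status D (TwoCopiesLocal r D)} (h : Locked H s₀ s st)
    (hs₀ : (Set.range s₀).encard ≤ m) (hH : n + m < r + H.card)
    (hown : ∀ p, OwnPairs s p (st p)) : ¬ Function.Injective s := by
  classical
  intro hinj
  have hex : ∀ j, ∃ x, s j = some x := fun j => Option.ne_none_iff_exists'.1 (h.full j)
  choose x hx using hex
  have h1 : (Finset.univ.filter fun j => (x j).2 ∈ H).card ≤ m := by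
    have hsub : s '' {j | (x j).2 ∈ H} ⊆ Set.range s₀ := by
      rintro _ ⟨j, hj, rfl⟩
      have := h.old _ hj j (x j).1 (hx j)
      rwa [hx j]
    have := (Set.encard_le_encard hsub).trans hs₀
    rw [hinj.encard_image] at this
    have h2 : {j | (x j).2 ∈ H} = ((Finset.univ.filter fun j => (x j).2 ∈ H : Finset (Fin r)) :
        Set (Fin r)) := by ext; simp
    rw [h2, Set.encard_coe_eq_coe_finsetCard] at this
    exact_mod_cast this
  have h2 : (Finset.univ.filter fun j => ¬ (x j).2 ∈ H).card ≤ Hᶜ.card := by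
    refine Finset.card_le_card_of_injOn (fun j => (x j).2) (fun j hj => by simpa using hj) ?_
    intro j _ j' _ hjj'
    apply hinj
    have e1 : s j = some ((x j).1, (x j).2) := hx j
    have e2 : s j' = some ((x j').1, (x j).2) := by
      rw [hx j']; exact congrArg some (Prod.ext rfl hjj'.symm)
    rw [e1, e2, (hown _).unique e1 e2]
  have h3 := Finset.card_filter_add_card_filter_not (s := (Finset.univ : Finset (Fin r)))
    (fun j => (x j).2 ∈ H)
  rw [Finset.card_univ, Fintype.card_fin] at h3
  rw [Finset.card_compl, Fintype.card_fin] at h2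
  have h4 := Finset.card_le_univ H
  rw [Fintype.card_fin] at h4
  omega

/-- A repeated pair belongs either to `H`, and is then left over from `s₀`, or to another process,
which has at most one component with a value outside `memValues s₀`. -/
theorem Locked.repeatedValue_mem {H : Finset (Fin n)} {s₀ s : Fin r → Option (D × Fin n)}
    {st : Fin n → Status D (TwoCopiesLocal r D)} (h : Locked H s₀ s st) {w : D}
    (hw : repeatedValue s = some w) : w ∈ memValues s₀ := by
  obtain ⟨j₁, j₂, q, hlt, h1, h2, -⟩ := exists_of_repeatedValue_eq_some hw
  by_cases hq : q ∈ H
  · obtain ⟨j, hj⟩ := h.old q hq j₁ w h1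
    exact ⟨j, q, hj⟩
  · by_contra hV
    exact hlt.ne ((h.outside q hq).atMostOne j₁ j₂ w w h1 hV h2 hV)

/-- The invariant could break only if a process kept a preference outside `memValues s₀` and moved
on to write a second copy of it. But memory is full and not injective, so its scan finds a repeated
value, which lies in `memValues s₀`. -/
theorem Locked.step {H : Finset (Fin n)} {s₀ s s' : Fin r → Option (D × Fin n)}
    {st st' : Fin n → Status D (TwoCopiesLocal r D)} {e : Event n D} (h : Locked H s₀ s st)
    (hstep : TwoCopiesStep m hr s st e s' st')
    (hs₀ : (Set.range s₀).encard ≤ m) (hH : n + m < r + H.card)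
    (hown : ∀ p, OwnPairs s p (st p)) : Locked H s₀ s' st' := by
  have hdec : ∀ p ∈ H, (decision (st' p)).isSome := fun p hp => by
    obtain ⟨v, hv⟩ := Option.isSome_iff_exists.1 (h.decided p hp)
    rw [hstep.decision_mono hv]; rfl
  have hown' := hstep.ownPairs hown
  cases hstep with
  | invoke q v hq =>
    refine ⟨h.full, hdec, h.old, fun p hp => ?_⟩
    by_cases hpq : p = q
    · subst hpq
      have := h.outside p hp
      rw [hq] at this
      rw [Function.update_self]
      exact .of_forall_mem this (by simp [decision])
    · rw [Function.update_of_ne hpq]; exact h.outside p hp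
  | update q pref i hq =>
    have hqH : q ∉ H := fun hqH => by simpa [hq, decision] using h.decided q hqH
    refine ⟨fun j => ?_, hdec, fun p hp j v hj => ?_, fun p hp => ?_⟩
    · by_cases hj : j = i
      · subst hj; simp
      · rw [Function.update_of_ne hj]; exact h.full j
    · exact h.old p hp j v (eq_some_of_update_eq_some (ne_of_mem_of_not_mem hp hqH) hj)
    · by_cases hpq : p = q
      · subst hpq
        have h1 := h.outside p hp
        rw [hq] at h1
        have h2 := hown' p
        rw [Function.update_self] at h2 ⊢
        intro j v hj hv
        by_contra hji
        have hvp := h2 j v hj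
        subst hvp
        rw [Function.update_of_ne hji] at hj
        exact hv (h1.1 hv j v hj)
      · rw [Function.update_of_ne hpq]
        exact (h.outside p hp).mono fun j v hj => eq_some_of_update_eq_some hpq hj
  | scan q pref i hq =>
    refine ⟨h.full, hdec, h.old, fun p hp => ?_⟩
    by_cases hpq : p = q
    · subst hpq
      have h1 := h.outside p hp
      have hone := h1.atMostOne
      rw [hq] at h1
      rw [Function.update_self]
      rcases afterScan_cases m hr p pref i s with ⟨w, hw, -, hw'⟩ | ⟨w, hw, -, hw'⟩ | ⟨hw, hw'⟩
      · rw [hw']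
        exact ⟨h.repeatedValue_mem hw, hone⟩
      · rw [hw']
        exact ⟨fun hV => absurd (h.repeatedValue_mem hw) hV, hone⟩
      · rw [hw']
        refine ⟨fun hV => ?_, hone⟩
        obtain ⟨w, hws⟩ := exists_repeatedValue h.full (h.not_injective hs₀ hH hown)
        -- With `pref` outside `memValues s₀`, its only copy is in component `i` and the repeated
        -- value differs from it. All conditions for adoption hold, so the process cannot have
        -- advanced.
        refine absurd ⟨fun j hj => ⟨h.full j, fun hjp => hj (h1 j pref hjp hV)⟩, ?_⟩ (hw w hws).2
        rintro rfl
        exact hV (h.repeatedValue_mem hws)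
    · rw [Function.update_of_ne hpq]; exact h.outside p hp
  | respond q v hq =>
    refine ⟨h.full, hdec, h.old, fun p hp => ?_⟩
    by_cases hpq : p = q
    · subst hpq
      have := h.outside p hp
      rw [hq] at this
      rw [Function.update_self]
      exact this
    · rw [Function.update_of_ne hpq]; exact h.outside p hp

/-! ### Invariants along a trace and the bound on outputs -/

/-- The contents of the snapshot object at time `t`. -/
noncomputable def cells (τ : (twoCopies n m r hr D).Trace) (t : ℕ) : Fin r → Option (D × Fin n) := τ.mem t

/-- The status of all processes at time `t`, with local states unfolded. -/
noncomputable def stat (τ : (twoCopies n m r hr D).Trace) (t : ℕ) : Fin n → Status D (TwoCopiesLocal r D) :=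
  τ.status t

theorem trace_step {τ : (twoCopies n m r hr D).Trace} {t : ℕ} {e : Event n D}
    (h : τ.event t = some e) :
    TwoCopiesStep m hr (cells τ t) (stat τ t) e (cells τ (t + 1)) (stat τ (t + 1)) :=
  twoCopies_step (τ.step_some t e h)

theorem trace_stutter {τ : (twoCopies n m r hr D).Trace} {t : ℕ} (h : τ.event t = none) :
    cells τ (t + 1) = cells τ t ∧ stat τ (t + 1) = stat τ t := by
  have := τ.step_none t h
  exact ⟨congrArg Config.mem this, congrArg Config.status this⟩

/-- Induction along a trace of the two-copies algorithm. -/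
theorem trace_induction {τ : (twoCopies n m r hr D).Trace}
    {P : (Fin r → Option (D × Fin n)) → (Fin n → Status D (TwoCopiesLocal r D)) → Prop} {a b : ℕ}
    (hab : a ≤ b) (h0 : P (cells τ a) (stat τ a))
    (hs : ∀ t ≥ a, ∀ e, τ.event t = some e → P (cells τ t) (stat τ t) →
      P (cells τ (t + 1)) (stat τ (t + 1))) : P (cells τ b) (stat τ b) := by
  induction b, hab using Nat.le_induction with
  | base => exact h0
  | succ t ht ih =>
    rcases he : τ.event t with _ | e
    · rw [(trace_stutter he).1, (trace_stutter he).2]; exact ih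
    · exact hs t ht e he ih

theorem cells_zero (τ : (twoCopies n m r hr D).Trace) (j : Fin r) : cells τ 0 j = none := by
  simp only [cells, Trace.mem_zero]; rfl

theorem stat_zero (τ : (twoCopies n m r hr D).Trace) (p : Fin n) : stat τ 0 p = .ready :=
  Trace.status_zero p

theorem trace_ownPairs (τ : (twoCopies n m r hr D).Trace) (t : ℕ) (p : Fin n) :
    OwnPairs (cells τ t) p (stat τ t p) := by
  refine trace_induction (P := fun s st => ∀ p, OwnPairs s p (st p)) t.zero_le (fun p => ?_)
    (fun t _ e he ih => (trace_step he).ownPairs ih) p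
  rw [stat_zero]
  intro j v
  rw [cells_zero]; simp

theorem decision_mono {τ : (twoCopies n m r hr D).Trace} {a b : ℕ} (hab : a ≤ b) {p : Fin n}
    {v : D} (h : decision (stat τ a p) = some v) : decision (stat τ b p) = some v :=
  trace_induction (P := fun _ st => decision (st p) = some v) hab h
    fun _ _ _ he ih => (trace_step he).decision_mono ih

/-- The value held by an active process, as preference or as decision, and by a done process. -/
def heldValue : Status D (TwoCopiesLocal r D) → Option D
  | .ready => none
  | .active (.update v _) => some v
  | .active (.scan v _) => some v
  | .active (.output v) => some v
  | .done v => some v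

theorem trace_valid (τ : (twoCopies n m r hr D).Trace) (t : ℕ) :
    (∀ p v, heldValue (stat τ t p) = some v → v ∈ τ.inputs) ∧
      memValues (cells τ t) ⊆ τ.inputs := by
  refine trace_induction (P := fun s st => (∀ p v, heldValue (st p) = some v → v ∈ τ.inputs) ∧
      memValues s ⊆ τ.inputs) t.zero_le ⟨fun p v => ?_, ?_⟩ (fun t _ e he ih => ?_)
  · rw [stat_zero]; simp [heldValue]
  · rintro v ⟨j, q, h⟩
    rw [cells_zero] at h; cases h
  · have hst := trace_step he
    obtain ⟨ih1, ih2⟩ := ih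
    generalize hs : cells τ t = s, hst0 : stat τ t = st, cells τ (t + 1) = s',
      stat τ (t + 1) = st' at *
    have key : ∀ q x, (∀ v, heldValue x = some v → v ∈ τ.inputs) → ∀ p v,
        heldValue (Function.update st q x p) = some v → v ∈ τ.inputs := by
      intro q x hx p v hv
      by_cases hpq : p = q
      · subst hpq; rw [Function.update_self] at hv; exact hx v hv
      · rw [Function.update_of_ne hpq] at hv; exact ih1 p v hv
    cases hst with
    | invoke q v h =>
      refine ⟨key q _ fun w hw => ?_, ih2⟩
      cases hw
      exact ⟨t, q, he⟩
    | update q pref i h =>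
      have hpref : pref ∈ τ.inputs := ih1 q pref (by rw [h]; rfl)
      refine ⟨key q _ fun w hw => ?_, ?_⟩
      · cases hw; exact hpref
      · rintro v ⟨j, p, hj⟩
        by_cases hji : j = i
        · subst hji; rw [Function.update_self] at hj; cases hj; exact hpref
        · rw [Function.update_of_ne hji] at hj; exact ih2 ⟨j, p, hj⟩
    | scan q pref i h =>
      have hpref : pref ∈ τ.inputs := ih1 q pref (by rw [h]; rfl)
      have hrep : ∀ w, repeatedValue s = some w → w ∈ τ.inputs := fun w hw => by
        obtain ⟨j₁, _, p, _, hj, _⟩ := exists_of_repeatedValue_eq_some hw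
        exact ih2 ⟨j₁, p, hj⟩
      refine ⟨key q _ fun v hv => ?_, ih2⟩
      rcases afterScan_cases m hr q pref i s with ⟨w, hw, -, hw'⟩ | ⟨w, hw, -, hw'⟩ | ⟨hw, hw'⟩ <;>
        rw [hw'] at hv <;> cases hv
      · exact hrep _ hw
      · exact hrep _ hw
      · exact hpref
    | respond q v h =>
      refine ⟨key q _ fun w hw => ?_, ih2⟩
      cases hw
      exact ih1 q v (by rw [h]; rfl)

theorem decision_of_respond {τ : (twoCopies n m r hr D).Trace} {t : ℕ} {p : Fin n} {v : D}
    (h : τ.event t = some (.respond p v)) : decision (stat τ t p) = some v := by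
  have := trace_step h
  generalize cells τ t = s, stat τ t = st, cells τ (t + 1) = s', stat τ (t + 1) = st' at this ⊢
  cases this with
  | respond _ _ h' => rw [h']; rfl

open scoped Classical in
/-- The processes that have decided by time `t`. -/
noncomputable def decidedBy (τ : (twoCopies n m r hr D).Trace) (t : ℕ) : Finset (Fin n) :=
  Finset.univ.filter fun p => (decision (stat τ t p)).isSome

theorem mem_decidedBy {τ : (twoCopies n m r hr D).Trace} {t : ℕ} {p : Fin n} :
    p ∈ decidedBy τ t ↔ ∃ v, decision (stat τ t p) = some v := by
  simp [decidedBy, Option.isSome_iff_exists]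

theorem decidedBy_mono {τ : (twoCopies n m r hr D).Trace} {a b : ℕ} (hab : a ≤ b) :
    decidedBy τ a ⊆ decidedBy τ b := fun p hp => by
  obtain ⟨v, hv⟩ := mem_decidedBy.1 hp
  exact mem_decidedBy.2 ⟨v, decision_mono hab hv⟩

theorem encard_decisions_le (τ : (twoCopies n m r hr D).Trace) (t : ℕ) :
    {v | ∃ p, decision (stat τ t p) = some v}.encard ≤ (decidedBy τ t).card := by
  have : some '' {v | ∃ p, decision (stat τ t p) = some v} ⊆
      (fun p => decision (stat τ t p)) '' (decidedBy τ t : Set (Fin n)) := by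
    rintro _ ⟨v, ⟨p, h⟩, rfl⟩
    exact ⟨p, mem_decidedBy.2 ⟨v, h⟩, h⟩
  rw [← (Option.some_injective D).encard_image, ← Set.encard_coe_eq_coe_finsetCard]
  exact (Set.encard_le_encard this).trans (Set.encard_image_le _ _)

/-- The step by which the set of decided processes grows is a deciding scan. -/
theorem exists_scan_of_decidedBy_ne {τ : (twoCopies n m r hr D).Trace} {t : ℕ}
    (h : decidedBy τ (t + 1) ≠ decidedBy τ t) :
    cells τ (t + 1) = cells τ t ∧ (Set.range (cells τ t)).encard ≤ m ∧
      (∀ j, cells τ t j ≠ none) ∧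
      ∃ q w, repeatedValue (cells τ t) = some w ∧ decision (stat τ (t + 1) q) = some w ∧
        ∀ p ≠ q, stat τ (t + 1) p = stat τ t p := by
  have hex : ∃ p, (decision (stat τ (t + 1) p)).isSome ≠ (decision (stat τ t p)).isSome := by
    by_contra! hall
    exact h (by ext p; simp [decidedBy, hall p])
  obtain ⟨p, hp⟩ := hex
  rcases he : τ.event t with _ | e
  · rw [(trace_stutter he).2] at hp
    exact absurd rfl hp
  have hst := trace_step he
  generalize cells τ t = s, stat τ t = st, cells τ (t + 1) = s',
    stat τ (t + 1) = st' at *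
  cases hst with
  | scan q pref i hq =>
    have hpq : p = q := by
      by_contra hpq
      exact hp (by rw [Function.update_of_ne hpq])
    subst hpq
    rcases afterScan_cases m hr p pref i s with ⟨w, hw, hw1, hw'⟩ | ⟨w, hw, -, hw'⟩ | ⟨hw, hw'⟩
    · refine ⟨rfl, hw1.1, hw1.2, p, w, hw, ?_, fun p' hp' => Function.update_of_ne hp' _ _⟩
      rw [Function.update_self, hw']; rfl
    · simp [hw', hq, decision] at hp
    · simp [hw', hq, decision] at hp
  | invoke q v hq =>
    by_cases hpq : p = q
    · subst hpq; simp [hq, decision] at hp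
    · exact absurd (by rw [Function.update_of_ne hpq]) hp
  | update q v i hq =>
    by_cases hpq : p = q
    · subst hpq; simp [hq, decision] at hp
    · exact absurd (by rw [Function.update_of_ne hpq]) hp
  | respond q v hq =>
    by_cases hpq : p = q
    · subst hpq; simp [hq, decision] at hp
    · exact absurd (by rw [Function.update_of_ne hpq]) hp

/-- The values split as `k = (k - m) + m`: those decided before the critical scan, and those that
occur in this scan. -/
theorem encard_outputs_le {k : ℕ} (hmk : m ≤ k) (hrk : n + 2 * m ≤ r + k)
    (τ : (twoCopies n m r hr D).Trace) : τ.outputs.encard ≤ k := by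
  classical
  have hsub : ∀ v ∈ τ.outputs, ∃ t p, decision (stat τ t p) = some v := by
    rintro v ⟨t, p, h⟩
    exact ⟨t, p, decision_of_respond h⟩
  by_cases hex : ∃ t, k - m < (decidedBy τ t).card
  · obtain ⟨T, hT, hmin⟩ : ∃ T, k - m < (decidedBy τ T).card ∧
        ∀ t < T, (decidedBy τ t).card ≤ k - m :=
      ⟨Nat.find hex, Nat.find_spec hex, fun t ht => not_lt.1 (Nat.find_min hex ht)⟩
    have hT0 : T ≠ 0 := by
      rintro rfl
      have : decidedBy τ 0 = ∅ := by
        ext p; simp [mem_decidedBy, stat_zero, decision]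
      simp [this] at hT
    obtain ⟨t₀, rfl⟩ := Nat.exists_eq_succ_of_ne_zero hT0
    have hprev := hmin t₀ t₀.lt_succ_self
    obtain ⟨hcell, hcard, hfull, q, w, hw, hq, hother⟩ := exists_scan_of_decidedBy_ne (t := t₀)
      (τ := τ) (fun h => by rw [Nat.succ_eq_add_one, h] at hT; omega)
    -- Right after the critical scan memory still equals `s₀`, so every value in it is allowed by
    -- definition.
    have hlock0 : Locked (decidedBy τ (t₀ + 1)) (cells τ t₀) (cells τ (t₀ + 1))
        (stat τ (t₀ + 1)) := by
      rw [hcell]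
      refine ⟨hfull, fun p hp => by simpa [decidedBy] using hp, fun p _ j v hj => ⟨j, hj⟩,
        fun p hp => .of_forall_mem (fun j v hj => ⟨j, p, hj⟩) fun v hv => ?_⟩
      exact absurd (mem_decidedBy.2 ⟨v, hv⟩) hp
    have hlock : ∀ t ≥ t₀ + 1, Locked (decidedBy τ (t₀ + 1)) (cells τ t₀) (cells τ t)
        (stat τ t) := fun t ht =>
      -- `OwnPairs` is carried along because `Locked.step` uses it for its count. The strict
      -- inequality needed there comes from at least `k - m + 1` processes having decided.
      (trace_induction (P := fun s st => (∀ p, OwnPairs s p (st p)) ∧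
        Locked (decidedBy τ (t₀ + 1)) (cells τ t₀) s st) ht
        ⟨trace_ownPairs τ _, hlock0⟩ fun t _ e he ih =>
          ⟨(trace_step he).ownPairs ih.1, ih.2.step (trace_step he) hcard
            (by have : k - m < (decidedBy τ (t₀ + 1)).card := hT
                omega) ih.1⟩).2
    have hout : τ.outputs ⊆ {v | ∃ p, decision (stat τ t₀ p) = some v} ∪
        memValues (cells τ t₀) := by
      intro v hv
      obtain ⟨t, p, hp⟩ := hsub v hv
      have hp' := decision_mono (le_max_left t (t₀ + 1)) hp
      have hL := hlock _ (le_max_right t (t₀ + 1))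
      by_cases hpH : p ∈ decidedBy τ (t₀ + 1)
      · obtain ⟨v', hv'⟩ := mem_decidedBy.1 hpH
        have : v' = v := by
          have := decision_mono (le_max_right t (t₀ + 1)) hv'
          rw [hp'] at this; cases this; rfl
        subst this
        by_cases hpq : p = q
        · subst hpq
          rw [hv'] at hq; cases hq
          -- The process that made the critical scan outputs a value it found in memory, so it adds
          -- nothing to the bound.
          obtain ⟨j, _, id, _, hj, _⟩ := exists_of_repeatedValue_eq_some hw
          exact .inr ⟨j, id, hj⟩
        · rw [hother p hpq] at hv'
          exact .inl ⟨p, hv'⟩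
      · have := hL.outside p hpH
        generalize stat τ (max t (t₀ + 1)) p = x at hp' this
        rcases x with _ | (⟨pref, i⟩ | ⟨pref, i⟩ | w) | w <;> cases hp'
        · exact .inr this.1
        · exact .inr this.1
    calc τ.outputs.encard ≤ _ := Set.encard_le_encard hout
      _ ≤ _ := Set.encard_union_le _ _
      _ ≤ ((k - m : ℕ) : ℕ∞) + m := by
        refine add_le_add ((encard_decisions_le τ t₀).trans (by exact_mod_cast hprev)) ?_
        exact (encard_memValues_le _).trans hcard
      _ = k := by
        rw [← Nat.cast_add, Nat.sub_add_cancel hmk]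
  · push Not at hex
    -- The number of deciders is bounded and so attains its maximum; from then on no new process
    -- decides.
    obtain ⟨T, hT⟩ : ∃ T, ∀ t, (decidedBy τ t).card ≤ (decidedBy τ T).card := by
      have hb : (Set.range fun t => (decidedBy τ t).card).Finite :=
        (Set.finite_Iic (k - m)).subset (by rintro _ ⟨t, rfl⟩; exact hex t)
      obtain ⟨_, ⟨T, rfl⟩, hmax⟩ := hb.exists_maximal (Set.range_nonempty _)
      refine ⟨T, fun t => ?_⟩
      rcases le_total (decidedBy τ t).card (decidedBy τ T).card with h | h
      · exact h
      · exact hmax ⟨t, rfl⟩ h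
    have hout : τ.outputs ⊆ {v | ∃ p, decision (stat τ T p) = some v} := by
      intro v hv
      obtain ⟨t, p, hp⟩ := hsub v hv
      have hp' := decision_mono (le_max_left t T) hp
      have heq := Finset.eq_of_subset_of_card_le (decidedBy_mono (τ := τ) (le_max_right t T))
        (hT _)
      obtain ⟨v', hv'⟩ := mem_decidedBy.1 (heq ▸ mem_decidedBy.2 ⟨v, hp'⟩ : p ∈ decidedBy τ T)
      have := decision_mono (le_max_right t T) hv'
      rw [hp'] at this; cases this
      exact ⟨p, hv'⟩
    calc τ.outputs.encard ≤ _ := Set.encard_le_encard hout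
      _ ≤ _ := encard_decisions_le τ T
      _ ≤ k := by exact_mod_cast (hex T).trans (Nat.sub_le k m)

theorem twoCopies_traceSolves {k : ℕ} (hmk : m ≤ k) (hrk : n + 2 * m ≤ r + k) :
    (twoCopies n m r hr D).TraceSolves k := by
  refine fun τ => ⟨?_, encard_outputs_le hmk hrk τ⟩
  rintro v ⟨t, p, h⟩
  have hd := decision_of_respond h
  refine (trace_valid τ t).1 p v ?_
  generalize stat τ t p = x at hd ⊢
  rcases x with _ | (⟨pref, i⟩ | ⟨pref, i⟩ | w) | w <;> cases hd <;> rfl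

end TwoCopies

/-! ### The two-copies algorithm: termination -/

section TwoCopiesTermination

variable {n m r : ℕ} {hr : 0 < r} {D : Type u} {τ : (twoCopies n m r hr D).Trace}

theorem afterScan_eq_output {p : Fin n} {pref w : D} {i : Fin r}
    {s : Fin r → Option (D × Fin n)} (hw : repeatedValue s = some w)
    (h : (Set.range s).encard ≤ m ∧ ∀ j, s j ≠ none) :
    afterScan m hr p pref i s = .output w := by
  unfold afterScan
  rw [hw]
  exact if_pos h

theorem move_update {t : ℕ} {p : Fin n} {pref : D} {i : Fin r} (hm : τ.Moves t p)
    (h : stat τ t p = .active (.update pref i)) :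
    cells τ (t + 1) = Function.update (cells τ t) i (some (pref, p)) ∧
      stat τ (t + 1) p = .active (.scan pref i) := by
  obtain ⟨e, he, rfl⟩ := hm
  have hst := trace_step he
  generalize cells τ t = s, stat τ t = st, cells τ (t + 1) = s', stat τ (t + 1) = st' at *
  cases hst with
  | invoke q v hq => rw [Event.proc, hq] at h; cases h
  | update q v j hq =>
    rw [Event.proc, hq] at h; cases h
    exact ⟨rfl, Function.update_self _ _ _⟩
  | scan q v j hq => rw [Event.proc, hq] at h; cases h
  | respond q v hq => rw [Event.proc, hq] at h; cases h

theorem move_scan {t : ℕ} {p : Fin n} {pref : D} {i : Fin r} (hm : τ.Moves t p)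
    (h : stat τ t p = .active (.scan pref i)) :
    stat τ (t + 1) p = .active (afterScan m hr p pref i (cells τ t)) := by
  obtain ⟨e, he, rfl⟩ := hm
  have hst := trace_step he
  generalize cells τ t = s, stat τ t = st, cells τ (t + 1) = s', stat τ (t + 1) = st' at *
  cases hst with
  | invoke q v hq => rw [Event.proc, hq] at h; cases h
  | update q v j hq => rw [Event.proc, hq] at h; cases h
  | scan q v j hq =>
    rw [Event.proc, hq] at h; cases h
    exact Function.update_self _ _ _
  | respond q v hq => rw [Event.proc, hq] at h; cases h

theorem move_output {t : ℕ} {p : Fin n} {v : D} (hm : τ.Moves t p)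
    (h : stat τ t p = .active (.output v)) : stat τ (t + 1) p = .done v := by
  obtain ⟨e, he, rfl⟩ := hm
  have hst := trace_step he
  generalize cells τ t = s, stat τ t = st, cells τ (t + 1) = s', stat τ (t + 1) = st' at *
  cases hst with
  | invoke q v hq => rw [Event.proc, hq] at h; cases h
  | update q v j hq => rw [Event.proc, hq] at h; cases h
  | scan q v j hq => rw [Event.proc, hq] at h; cases h
  | respond q v hq =>
    rw [Event.proc, hq] at h; cases h
    exact Function.update_self _ _ _

theorem move_ready {t : ℕ} {p : Fin n} (hm : τ.Moves t p) : stat τ (t + 1) p ≠ .ready := by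
  obtain ⟨e, he, rfl⟩ := hm
  have hst := trace_step he
  generalize cells τ t = s, stat τ t = st, cells τ (t + 1) = s', stat τ (t + 1) = st' at *
  cases hst <;> simp [Event.proc]

theorem cells_succ (τ : (twoCopies n m r hr D).Trace) (t : ℕ) (j : Fin r) :
    cells τ (t + 1) j = cells τ t j ∨ ∃ p pref, τ.Moves t p ∧
      stat τ t p = .active (.update pref j) ∧ cells τ (t + 1) j = some (pref, p) := by
  rcases he : τ.event t with _ | e
  · exact .inl (congrFun (trace_stutter he).1 j)
  have hm : τ.Moves t e.proc := ⟨e, he, rfl⟩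
  have hst := trace_step he
  generalize cells τ t = s, stat τ t = st, cells τ (t + 1) = s', stat τ (t + 1) = st' at *
  cases hst with
  | invoke q v hq => exact .inl rfl
  | update q v i hq =>
    by_cases hj : j = i
    · subst hj
      exact .inr ⟨q, v, hm, hq, Function.update_self _ _ _⟩
    · exact .inl (Function.update_of_ne hj _ _)
  | scan q v j hq => exact .inl rfl
  | respond q v hq => exact .inl rfl

/-- Decisions are irrevocable, and the first step after one is the response, which is the last step
of the process. -/
theorem decision_eq_none {p : Fin n} (hp : τ.Live p) (t : ℕ) : decision (stat τ t p) = none := by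
  by_contra h
  obtain ⟨v, hv⟩ := Option.ne_none_iff_exists'.1 h
  obtain ⟨t', ht', hm⟩ := hp.exists_ge t
  have hv' := decision_mono ht' hv
  have hnd : ∀ w, stat τ t' p ≠ .done w := hp.not_done t'
  have hout : ∀ w, stat τ t' p ≠ .active (.output w) := fun w hw =>
    hp.not_done (t' + 1) w (move_output hm hw)
  generalize stat τ t' p = x at hv' hnd hout
  rcases x with _ | (⟨pref, i⟩ | ⟨pref, i⟩ | w) | w
  · cases hv'
  · cases hv'
  · cases hv'
  · exact hout w rfl
  · exact hnd w rfl

/-- The process is in its loop, working on component `i`. -/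
def LoopsAt (i : Fin r) (x : Status D (TwoCopiesLocal r D)) : Prop :=
  ∃ pref, x = .active (.update pref i) ∨ x = .active (.scan pref i)

theorem LoopsAt.eq {i j : Fin r} {x : Status D (TwoCopiesLocal r D)} (hi : LoopsAt i x)
    (hj : LoopsAt j x) : i = j := by
  obtain ⟨_, rfl | rfl⟩ := hi <;> obtain ⟨_, h | h⟩ := hj <;> cases h <;> rfl

theorem exists_forall_loopsAt {p : Fin n} (hp : τ.Live p) :
    ∃ T, ∀ t ≥ T, ∃ i, LoopsAt i (stat τ t p) := by
  obtain ⟨t₀, -, hm⟩ := hp.exists_ge 0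
  have hnr : ∀ t ≥ t₀ + 1, stat τ t p ≠ .ready := fun t ht => by
    induction t, ht using Nat.le_induction with
    | base => exact move_ready hm
    | succ t ht ih =>
      by_cases h : τ.Moves t p
      · exact move_ready h
      · rw [show stat τ (t + 1) p = stat τ t p from Trace.status_succ_of_not_moves h]
        exact ih
  refine ⟨t₀ + 1, fun t ht => ?_⟩
  have h1 := hnr t ht
  have h2 := decision_eq_none hp t
  generalize stat τ t p = x at h1 h2
  rcases x with _ | (⟨pref, i⟩ | ⟨pref, i⟩ | w) | w
  · exact absurd rfl h1
  · exact ⟨i, pref, .inl rfl⟩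
  · exact ⟨i, pref, .inr rfl⟩
  · cases h2
  · cases h2

theorem exists_move_scan {p : Fin n} (hp : τ.Live p) (a : ℕ) :
    ∃ t ≥ a, τ.Moves t p ∧ ∃ pref i, stat τ t p = .active (.scan pref i) := by
  obtain ⟨T, hT⟩ := exists_forall_loopsAt hp
  obtain ⟨t, ht, hm, -⟩ := hp.next_move (max a T)
  obtain ⟨i, pref, h | h⟩ := hT t (by omega)
  · obtain ⟨t', ht', hm', hst⟩ := hp.next_move (t + 1)
    exact ⟨t', by omega, hm', pref, i, hst.trans (move_update hm h).2⟩
  · exact ⟨t, by omega, hm, pref, i, h⟩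

theorem not_output_of_live {p : Fin n} (hp : τ.Live p) (t : ℕ) (w : D) :
    stat τ t p ≠ .active (.output w) := fun h => by
  have := decision_eq_none hp t
  rw [h] at this
  cases this

theorem exists_update {p : Fin n} (hp : τ.Live p) (a : ℕ) :
    ∃ t ≥ a, ∃ pref i, stat τ t p = .active (.update pref i) := by
  obtain ⟨t, ht, hm, pref, i, h⟩ := exists_move_scan hp a
  have h' := move_scan hm h
  rcases afterScan_cases m hr p pref i (cells τ t) with ⟨w, -, -, hw⟩ | ⟨w, -, -, hw⟩ | ⟨-, hw⟩
  · rw [hw] at h'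
    exact absurd h' (not_output_of_live hp _ _)
  · exact ⟨t + 1, by omega, _, _, h'.trans (by rw [hw])⟩
  · exact ⟨t + 1, by omega, _, _, h'.trans (by rw [hw])⟩

/-- A component written by a live process after all others have stopped keeps a live owner. -/
theorem owner_live {T₀ : ℕ} (hT₀ : ∀ t ≥ T₀, ∀ p, τ.Moves t p → τ.Live p) {a b : ℕ} (ha : T₀ ≤ a)
    (hab : a ≤ b) {j : Fin r} (h : ∃ v q, τ.Live q ∧ cells τ a j = some (v, q)) :
    ∃ v q, τ.Live q ∧ cells τ b j = some (v, q) := by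
  induction b, hab using Nat.le_induction with
  | base => exact h
  | succ t ht ih =>
    rcases cells_succ τ t j with h | ⟨p, pref, hm, -, h⟩
    · rwa [h]
    · exact ⟨pref, p, hT₀ t (ha.trans ht) p hm, h⟩

/-- Sending a pair to its owner is injective on the contents of memory, by `OwnPairs.unique`, and
all owners are live. -/
theorem encard_range_cells_le (hI : {p | τ.Live p}.encard ≤ m) {t : ℕ}
    (h : ∀ j, ∃ v q, τ.Live q ∧ cells τ t j = some (v, q)) :
    (Set.range (cells τ t)).encard ≤ m := by
  refine le_trans ?_ hI
  rw [← (Option.some_injective (Fin n)).encard_image]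
  refine Set.encard_le_encard_of_injOn (f := Option.map Prod.snd) ?_ ?_
  · rintro _ ⟨j, rfl⟩
    obtain ⟨v, q, hq, hj⟩ := h j
    exact ⟨q, hq, by rw [hj]; rfl⟩
  · rintro _ ⟨j, rfl⟩ _ ⟨j', rfl⟩ heq
    obtain ⟨v, q, hq, hj⟩ := h j
    obtain ⟨v', q', hq', hj'⟩ := h j'
    rw [hj, hj'] at heq ⊢
    have : q = q' := by simpa using heq
    subst this
    obtain rfl := (trace_ownPairs τ t q).unique hj hj'
    rfl

/-- Some component is never written once only live processes take steps. -/
theorem exists_unwritten (hmr : m < r) (hI : {p | τ.Live p}.encard ≤ m) {p₀ : Fin n}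
    (hp₀ : τ.Live p₀) {T₀ : ℕ} (hT₀ : ∀ t ≥ T₀, ∀ p, τ.Moves t p → τ.Live p) :
    ∃ j₀ : Fin r, ∀ t ≥ T₀, ∀ p pref, τ.Moves t p → stat τ t p ≠ .active (.update pref j₀) := by
  by_contra! hall
  choose T hT p pref hm hst using hall
  have hlive : ∀ t ≥ Finset.univ.sup T + 1, ∀ j, ∃ v q, τ.Live q ∧ cells τ t j = some (v, q) := by
    intro t ht j
    have hj : T j ≤ Finset.univ.sup T := Finset.le_sup (Finset.mem_univ j)
    have hTj := hT j
    refine owner_live hT₀ (a := T j + 1) (by omega) (by omega)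
      ⟨pref j, p j, hT₀ _ (hT j) _ (hm j), ?_⟩
    rw [(move_update (hm j) (hst j)).1, Function.update_self]
  obtain ⟨t, ht, hmv, pref', i, hs⟩ := exists_move_scan hp₀ (Finset.univ.sup T + 1)
  have hcard := encard_range_cells_le hI (hlive t ht)
  have hfull : ∀ j, cells τ t j ≠ none := fun j => by
    obtain ⟨v, q, -, h⟩ := hlive t ht j
    rw [h]; simp
  obtain ⟨w, hw⟩ := exists_repeatedValue hfull (not_injective_of_encard_range_le hmr hcard)
  have := move_scan hmv hs
  rw [afterScan_eq_output hw ⟨hcard, hfull⟩] at this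
  exact not_output_of_live hp₀ _ _ this

/-- The cyclic distance from `i` to `j₀`. -/
def cyclicDist (j₀ i : Fin r) : ℕ := if i ≤ j₀ then j₀ - i else j₀ + r - i

theorem cyclicDist_next_lt {j₀ i : Fin r} (h : i ≠ j₀) :
    cyclicDist j₀ ⟨(i + 1) % r, Nat.mod_lt _ hr⟩ < cyclicDist j₀ i := by
  have h0 := j₀.isLt
  have h1 := i.isLt
  have h2 : (i : ℕ) ≠ j₀ := fun h' => h (Fin.ext h')
  have h3 : ((i : ℕ) + 1) % r = if (i : ℕ) + 1 = r then 0 else (i : ℕ) + 1 := by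
    split_ifs with h3
    · rw [h3, Nat.mod_self]
    · exact Nat.mod_eq_of_lt (by omega)
  simp only [cyclicDist, Fin.le_def, h3]
  split_ifs <;> omega

/-- Each advance of the index decreases its cyclic distance to `j₀`, and the index never reaches
`j₀`, since the process would then write there. A state of least distance is therefore final. -/
theorem exists_loopsAt_const {j₀ : Fin r} {T₀ : ℕ}
    (hj₀ : ∀ t ≥ T₀, ∀ p pref, τ.Moves t p → stat τ t p ≠ .active (.update pref j₀))
    {p : Fin n} (hp : τ.Live p) : ∃ T i, ∀ t ≥ T, LoopsAt i (stat τ t p) := by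
  classical
  have hupd : ∀ t ≥ T₀, ∀ pref i, stat τ t p = .active (.update pref i) → i ≠ j₀ := by
    rintro t ht pref i h rfl
    obtain ⟨t', ht', hm, hst⟩ := hp.next_move t
    exact hj₀ t' (ht.trans ht') p pref hm (hst.trans h)
  obtain ⟨t₁, ht₁, pref₁, i₁, h₁⟩ := exists_update hp T₀
  have hnext : ∀ t ≥ T₀, ∀ i, i ≠ j₀ → LoopsAt i (stat τ t p) →
      LoopsAt i (stat τ (t + 1) p) ∨
        ∃ i', i' ≠ j₀ ∧ LoopsAt i' (stat τ (t + 1) p) ∧ cyclicDist j₀ i' < cyclicDist j₀ i := by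
    rintro t ht i hi ⟨pref, h⟩
    by_cases hm : τ.Moves t p
    · rcases h with h | h
      · exact .inl ⟨pref, .inr (move_update hm h).2⟩
      · have hs := move_scan hm h
        rcases afterScan_cases m hr p pref i (cells τ t) with
          ⟨w, -, -, hw⟩ | ⟨w, -, -, hw⟩ | ⟨-, hw⟩
        · rw [hw] at hs
          exact absurd hs (not_output_of_live hp _ _)
        · exact .inl ⟨w, .inl (hs.trans (by rw [hw]))⟩
        · rw [hw] at hs
          exact .inr ⟨_, hupd (t + 1) (by omega) _ _ hs, ⟨pref, .inl hs⟩, cyclicDist_next_lt (hr := hr) hi⟩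
    · rw [show stat τ (t + 1) p = stat τ t p from Trace.status_succ_of_not_moves hm]
      exact .inl ⟨pref, h⟩
  have hloop : ∀ t ≥ t₁, ∃ i, i ≠ j₀ ∧ LoopsAt i (stat τ t p) := fun t ht => by
    induction t, ht using Nat.le_induction with
    | base => exact ⟨i₁, hupd t₁ ht₁ _ _ h₁, pref₁, .inl h₁⟩
    | succ t ht ih =>
      obtain ⟨i, hi, hl⟩ := ih
      rcases hnext t (ht₁.trans ht) i hi hl with h | ⟨i', h1, h2, -⟩
      · exact ⟨i, hi, h⟩
      · exact ⟨i', h1, h2⟩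
  have hex : ∃ d, ∃ t ≥ t₁, ∃ i, i ≠ j₀ ∧ LoopsAt i (stat τ t p) ∧ cyclicDist j₀ i = d := by
    obtain ⟨i, hi, hl⟩ := hloop t₁ le_rfl
    exact ⟨_, t₁, le_rfl, i, hi, hl, rfl⟩
  obtain ⟨T, hT, i, hi, hl, hd⟩ := Nat.find_spec hex
  refine ⟨T, i, fun t ht => ?_⟩
  induction t, ht using Nat.le_induction with
  | base => exact hl
  | succ t ht ih =>
    rcases hnext t (by omega) i hi ih with h | ⟨i', h1, h2, h3⟩
    · exact h
    · exact absurd ⟨t + 1, by omega, i', h1, h2, rfl⟩ (Nat.find_min hex (hd ▸ h3))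

theorem twoCopies_traceTerminates (hmr : m < r) : (twoCopies n m r hr D).TraceTerminates m := by
  classical
  intro τ hI p₀ hp₀
  -- Together with `m < r` this gives `r ≥ 2`, so that advancing really changes the index; needed
  -- for `hadopt`.
  have hm1 : 1 ≤ m := by
    have h1 : ({p₀} : Set (Fin n)).encard ≤ {p | τ.Live p}.encard :=
      Set.encard_le_encard (Set.singleton_subset_iff.2 hp₀)
    rw [Set.encard_singleton] at h1
    exact_mod_cast h1.trans hI
  obtain ⟨T₀, hT₀⟩ := τ.exists_forall_live
  obtain ⟨j₀, hj₀⟩ := exists_unwritten hmr hI hp₀ hT₀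
  obtain ⟨T₁, hT₁, idx, hloop⟩ : ∃ T₁ ≥ T₀, ∃ idx : Fin n → Fin r,
      ∀ p, τ.Live p → ∀ t ≥ T₁, LoopsAt (idx p) (stat τ t p) := by
    have : ∀ p, ∃ T i, τ.Live p → ∀ t ≥ T, LoopsAt i (stat τ t p) := fun p => by
      by_cases hp : τ.Live p
      · obtain ⟨T, i, h⟩ := exists_loopsAt_const hj₀ hp
        exact ⟨T, i, fun _ => h⟩
      · exact ⟨0, j₀, fun h => absurd h hp⟩
    choose T idx h using this
    refine ⟨max T₀ (Finset.univ.sup T), le_max_left _ _, idx, fun p hp t ht => h p hp t ?_⟩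
    exact (Finset.le_sup (Finset.mem_univ p)).trans ((le_max_right _ _).trans ht)
  -- from `T₁` on, every scan of a live process makes it adopt another value
  have hadopt : ∀ p, τ.Live p → ∀ t ≥ T₁, ∀ pref i, τ.Moves t p →
      stat τ t p = .active (.scan pref i) → i = idx p ∧ ∃ w, repeatedValue (cells τ t) = some w ∧
        w ≠ pref ∧ (∀ j, j ≠ i → cells τ t j ≠ some (pref, p)) ∧
        stat τ (t + 1) p = .active (.update w i) := by
    intro p hp t ht pref i hm h
    have hi : i = idx p := LoopsAt.eq ⟨pref, .inr h⟩ (hloop p hp t ht)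
    refine ⟨hi, ?_⟩
    have hs := move_scan hm h
    rcases afterScan_cases m hr p pref i (cells τ t) with
      ⟨w, -, -, hw⟩ | ⟨w, hrep, hc, hw⟩ | ⟨-, hw⟩
    · rw [hw] at hs
      exact absurd hs (not_output_of_live hp _ _)
    · exact ⟨w, hrep, hc.2, fun j hj => (hc.1 j hj).2, hs.trans (by rw [hw])⟩
    · rw [hw] at hs
      have h1 : ⟨((i : ℕ) + 1) % r, Nat.mod_lt _ hr⟩ = idx p :=
        LoopsAt.eq ⟨pref, .inl hs⟩ (hloop p hp (t + 1) (by omega))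
      rw [← hi, Fin.ext_iff] at h1
      have h2 := i.isLt
      have h3 : ((i : ℕ) + 1) % r = if (i : ℕ) + 1 = r then 0 else (i : ℕ) + 1 := by
        split_ifs with h3
        · rw [h3, Nat.mod_self]
        · exact Nat.mod_eq_of_lt (by omega)
      simp only [h3] at h1
      split_ifs at h1 <;> omega
  -- eventually the pairs of a live process occur only in its own component
  obtain ⟨T₂, hT₂, howner⟩ : ∃ T₂ ≥ T₁, ∀ p, τ.Live p → ∀ t ≥ T₂,
      (∀ j v, cells τ t j = some (v, p) → j = idx p) ∧
        ∃ v q, τ.Live q ∧ cells τ t (idx p) = some (v, q) := by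
    have : ∀ p, ∃ T ≥ T₁, τ.Live p → ∀ t ≥ T,
        (∀ j v, cells τ t j = some (v, p) → j = idx p) ∧
          ∃ v q, τ.Live q ∧ cells τ t (idx p) = some (v, q) := fun p => by
      by_cases hp : τ.Live p
      swap
      · exact ⟨T₁, le_rfl, fun h => absurd h hp⟩
      obtain ⟨t, ht, hm, pref, i, h⟩ := exists_move_scan hp T₁
      obtain ⟨rfl, w, -, -, hne, hst⟩ := hadopt p hp t ht pref i hm h
      -- The adopting scan at time `t` shows that no pair of `p` stands outside `idx p`; the update
      -- at time `t'` puts a live owner into `idx p`.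
      obtain ⟨t', ht', hm', hst'⟩ := hp.next_move (t + 1)
      have hw := (move_update hm' (hst'.trans hst)).1
      refine ⟨t' + 1, by omega, fun _ b hb => ⟨?_, ?_⟩⟩
      · have htb : t ≤ b := by omega
        clear hb
        induction b, htb using Nat.le_induction with
        | base =>
          intro j v hj
          have hown := trace_ownPairs τ t p
          rw [h] at hown
          by_contra hji
          exact hne j hji (hown j v hj ▸ hj)
        | succ b hb ih =>
          intro j v hj
          rcases cells_succ τ b j with h | ⟨q, pref', hmq, hq, h⟩
          · exact ih j v (h ▸ hj)
          · rw [h] at hj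
            cases hj
            exact LoopsAt.eq ⟨v, .inl hq⟩ (hloop p hp b (by omega))
      · refine owner_live hT₀ (by omega : T₀ ≤ t' + 1) hb ⟨w, p, hp, ?_⟩
        rw [hw, Function.update_self]
    choose T hT h using this
    refine ⟨max T₁ (Finset.univ.sup T), le_max_left _ _, fun p hp t ht => h p hp t ?_⟩
    exact (Finset.le_sup (Finset.mem_univ p)).trans ((le_max_right _ _).trans ht)
  have hconst : ∀ j, (∀ p, τ.Live p → j ≠ idx p) → ∀ t ≥ T₂, cells τ t j = cells τ T₂ j := by
    intro j hj t ht
    induction t, ht using Nat.le_induction with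
    | base => rfl
    | succ t ht ih =>
      rcases cells_succ τ t j with h | ⟨q, pref', hmq, hq, h⟩
      · rw [h, ih]
      · have hql := hT₀ t (by omega) q hmq
        exact absurd (LoopsAt.eq ⟨pref', .inl hq⟩ (hloop q hql t (by omega))) (hj q hql)
  have hrep : ∀ t ≥ T₂, ∀ w, repeatedValue (cells τ t) = some w →
      ∃ j₁ j₂ q, j₁ < j₂ ∧ cells τ T₂ j₁ = some (w, q) ∧ cells τ T₂ j₂ = some (w, q) ∧
        (∀ b ≥ T₂, cells τ b j₁ = cells τ T₂ j₁) ∧ (∀ b ≥ T₂, cells τ b j₂ = cells τ T₂ j₂) ∧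
        ∀ j < j₁, ∀ j', j < j' → cells τ t j ≠ cells τ t j' := by
    intro t ht w hw
    obtain ⟨j₁, j₂, q, hlt, h1, h2, hmin⟩ := exists_of_repeatedValue_eq_some hw
    -- A live owner has pairs in only one component, so a repeated pair belongs to a stopped
    -- process. Its components are then not the index of any live process, since those hold live
    -- owners, and no longer change.
    have hq : ¬ τ.Live q := fun hq => hlt.ne
      (((howner q hq t ht).1 j₁ w h1).trans ((howner q hq t ht).1 j₂ w h2).symm)
    have hfix : ∀ j, cells τ t j = some (w, q) → ∀ b ≥ T₂, cells τ b j = cells τ T₂ j := by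
      intro j hj
      refine hconst j fun p hp hjp => ?_
      obtain ⟨v, q', hq', h'⟩ := (howner p hp t ht).2
      rw [← hjp, hj] at h'
      cases h'
      exact hq hq'
    exact ⟨j₁, j₂, q, hlt, (hfix j₁ h1 t ht).symm.trans h1, (hfix j₂ h2 t ht).symm.trans h2,
      hfix j₁ h1, hfix j₂ h2, hmin⟩
  have huniq : ∀ t ≥ T₂, ∀ t' ≥ T₂, ∀ w w', repeatedValue (cells τ t) = some w →
      repeatedValue (cells τ t') = some w' → w = w' := by
    intro t ht t' ht' w w' hw hw'
    obtain ⟨a₁, a₂, q, hlt, h1, h2, c1, c2, hmin⟩ := hrep t ht w hw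
    obtain ⟨b₁, b₂, q', hlt', h1', h2', c1', c2', hmin'⟩ := hrep t' ht' w' hw'
    -- Both repetitions persist at both times, so the smaller first index would contradict the
    -- minimality of the other one.
    rcases lt_trichotomy a₁ b₁ with h | h | h
    · exact absurd (by rw [c1 t' ht', c2 t' ht', h1, h2]) (hmin' a₁ h a₂ hlt)
    · subst h
      rw [h1] at h1'
      cases h1'
      rfl
    · exact absurd (by rw [c1' t ht, c2' t ht, h1', h2']) (hmin b₁ h b₂ hlt')
  -- Two successive scans of `p₀`: the first makes it adopt the repeated value `w`, and the second
  -- demands a repeated value different from `w`.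
  obtain ⟨t, ht, hm, pref, i, h⟩ := exists_move_scan hp₀ T₂
  obtain ⟨-, w, hw, -, -, hst⟩ := hadopt p₀ hp₀ t (by omega) pref i hm h
  obtain ⟨t', ht', hm', hst'⟩ := hp₀.next_move (t + 1)
  have hs' := (move_update hm' (hst'.trans hst)).2
  obtain ⟨t'', ht'', hm'', hst''⟩ := hp₀.next_move (t' + 1)
  obtain ⟨-, w', hw', hne, -, -⟩ := hadopt p₀ hp₀ t'' (by omega) w i hm'' (hst''.trans hs')
  exact hne (huniq t ht t'' (by omega) w w' hw hw').symm

end TwoCopiesTermination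

/-! ### Simulation of a snapshot object by registers -/

section Simulation

/-- The contents of a register that simulates a component: the value and a unique tag. -/
abbrev TaggedCell (n : ℕ) (W : Type u) : Type u := W × Option (Fin n × ℕ)

/-- Local states of the simulation: at a local state `s` of the simulated algorithm with `c`
writes done so far, or scanning, with the view `f` confirmed for the first `j` registers. -/
inductive SimLocal (n r : ℕ) (W L : Type u) : Type u where
  | run (s : L) (c : ℕ)
  | look (s : L) (c : ℕ) (f : Fin r → TaggedCell n W) (j : ℕ)

variable {n r : ℕ} {W D : Type u}

/-- The local state after a scan that returns `view`. -/
def scanResult {L : Type u} (a : Action (snapshot r W) D L) (view : Fin r → W) (l : L) : L :=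
  match a with
  | .access .scan cont => cont view
  | _ => l

open scoped Classical in
/-- The local state after reading `x` in register `i` during a scan: if `x` agrees with the view,
confirm it, otherwise correct the view and begin a new pass. -/
noncomputable def afterRead {L : Type u} (s : L) (c : ℕ) (f : Fin r → TaggedCell n W) (i : Fin r)
    (x : TaggedCell n W) : SimLocal n r W L :=
  if x = f i then .look s c f (i + 1) else .look s c (Function.update f i x) 0

/-- The next step of the simulation. A scan reads the registers in order until all of them agree
with the current view in one pass. -/
noncomputable def simNext (A : Algorithm (snapshot r W) n D) (p : Fin n) :
    SimLocal n r W A.Local → Action (registers r (TaggedCell n W)) D (SimLocal n r W A.Local)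
  | .run s c =>
    match A.next p s with
    | .access (.update i v) cont =>
      .access (.write i (v, some (p, c))) fun _ => .run (cont PUnit.unit) (c + 1)
    -- Starting from the initial contents ensures that every entry of a view was at some time the
    -- contents of its register.
    | .access .scan _ => .compute (.look s c (fun i => (A.init i, none)) 0)
    | .compute s' => .compute (.run s' c)
    | .respond v => .respond v
  | .look s c f j =>
    if h : j < r then .access (.read ⟨j, h⟩) fun x => afterRead s c f ⟨j, h⟩ x
    else .compute (.run (scanResult (A.next p s) (fun i => (f i).1) s) c)

/-- The algorithm on registers that simulates an algorithm on a snapshot object. -/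
noncomputable def simulate (A : Algorithm (snapshot r W) n D) :
    Algorithm (registers r (TaggedCell n W)) n D where
  Local := SimLocal n r W A.Local
  init := fun i => (A.init i, none)
  start := fun p v => .run (A.start p v) 0
  next := simNext A

/-- The steps of the simulation, on register contents and statuses. -/
inductive SimStep (A : Algorithm (snapshot r W) n D) :
    (Fin r → TaggedCell n W) → (Fin n → Status D (SimLocal n r W A.Local)) → Event n D →
    (Fin r → TaggedCell n W) → (Fin n → Status D (SimLocal n r W A.Local)) → Prop where
  | invoke (x st p v) (h : st p = .ready) :
      SimStep A x st (.invoke p v) x (Function.update st p (.active (.run (A.start p v) 0)))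
  | update (x st p s c) (i : Fin r) (v : W) (cont : PUnit → A.Local)
      (h : st p = .active (.run s c)) (hs : A.next p s = .access (.update i v) cont) :
      SimStep A x st (.internal p) (Function.update x i (v, some (p, c)))
        (Function.update st p (.active (.run (cont PUnit.unit) (c + 1))))
  | start (x st p s c) (cont : (Fin r → W) → A.Local)
      (h : st p = .active (.run s c)) (hs : A.next p s = .access .scan cont) :
      SimStep A x st (.internal p) x
        (Function.update st p (.active (.look s c (fun i => (A.init i, none)) 0)))
  | compute (x st p s c) (s' : A.Local)
      (h : st p = .active (.run s c)) (hs : A.next p s = .compute s') :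
      SimStep A x st (.internal p) x (Function.update st p (.active (.run s' c)))
  | respond (x st p s c) (v : D)
      (h : st p = .active (.run s c)) (hs : A.next p s = .respond v) :
      SimStep A x st (.respond p v) x (Function.update st p (.done v))
  | hit (x st p s c f j) (hj : j < r) (h : st p = .active (.look s c f j))
      (hx : x ⟨j, hj⟩ = f ⟨j, hj⟩) :
      SimStep A x st (.internal p) x (Function.update st p (.active (.look s c f (j + 1))))
  | miss (x st p s c f j) (hj : j < r) (h : st p = .active (.look s c f j))
      (hx : x ⟨j, hj⟩ ≠ f ⟨j, hj⟩) :
      SimStep A x st (.internal p) x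
        (Function.update st p (.active (.look s c (Function.update f ⟨j, hj⟩ (x ⟨j, hj⟩)) 0)))
  | finish (x st p s c f j) (hj : r ≤ j) (h : st p = .active (.look s c f j)) :
      SimStep A x st (.internal p) x (Function.update st p
        (.active (.run (scanResult (A.next p s) (fun i => (f i).1) s) c)))

variable {A : Algorithm (snapshot r W) n D}

theorem simulate_step {y y' : (simulate A).Config} {e : Event n D}
    (h : (simulate A).Step y e y') : SimStep A y.mem y.status e y'.mem y'.status := by
  cases h with
  | invoke p v h => exact .invoke _ _ p v h
  | access p l o cont h hs =>
    cases l with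
    | run s c =>
      change simNext A p (.run s c) = _ at hs
      simp only [simNext] at hs
      rcases ha : A.next p s with ⟨⟨i, v⟩ | _, cont⟩ | s' | v <;> simp only [ha] at hs <;> cases hs
      exact .update _ _ p s c i v _ h ha
    | look s c f j =>
      change simNext A p (.look s c f j) = _ at hs
      simp only [simNext] at hs
      split_ifs at hs with hj
      cases hs
      change SimStep A y.mem y.status _ y.mem (Function.update y.status p (.active
        (afterRead s c f ⟨j, hj⟩ (y.mem ⟨j, hj⟩))))
      by_cases hx : y.mem ⟨j, hj⟩ = f ⟨j, hj⟩
      · rw [afterRead, if_pos hx]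
        exact .hit _ _ p s c f j hj h hx
      · rw [afterRead, if_neg hx]
        exact .miss _ _ p s c f j hj h hx
  | compute p l l' h hs =>
    cases l with
    | run s c =>
      change simNext A p (.run s c) = _ at hs
      simp only [simNext] at hs
      rcases ha : A.next p s with ⟨⟨i, v⟩ | _, cont⟩ | s' | v <;> simp only [ha] at hs <;> cases hs
      · exact .start _ _ p s c _ h ha
      · exact .compute _ _ p s c _ h ha
    | look s c f j =>
      change simNext A p (.look s c f j) = _ at hs
      simp only [simNext] at hs
      split_ifs at hs with hj
      cases hs
      exact .finish _ _ p s c f j (not_lt.1 hj) h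
  | respond p l v h hs =>
    cases l with
    | run s c =>
      change simNext A p (.run s c) = _ at hs
      simp only [simNext] at hs
      rcases ha : A.next p s with ⟨⟨i, v⟩ | _, cont⟩ | s' | v <;> simp only [ha] at hs <;> cases hs
      exact .respond _ _ p s c _ h ha
    | look s c f j =>
      change simNext A p (.look s c f j) = _ at hs
      simp only [simNext] at hs
      split_ifs at hs with hj

variable (τ : (simulate A).Trace)

/-- The register contents at time `t`. -/
noncomputable def regs (t : ℕ) : Fin r → TaggedCell n W := τ.mem t

/-- The statuses at time `t`. -/
noncomputable def simStat (t : ℕ) : Fin n → Status D (SimLocal n r W A.Local) := τ.status t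

variable {τ}

theorem sim_step {t : ℕ} {e : Event n D} (h : τ.event t = some e) :
    SimStep A (regs τ t) (simStat τ t) e (regs τ (t + 1)) (simStat τ (t + 1)) :=
  simulate_step (τ.step_some t e h)

theorem sim_stutter {t : ℕ} (h : τ.event t = none) :
    regs τ (t + 1) = regs τ t ∧ simStat τ (t + 1) = simStat τ t := by
  have := τ.step_none t h
  exact ⟨congrArg Config.mem this, congrArg Config.status this⟩

theorem simStat_succ_of_not_moves {t : ℕ} {p : Fin n} (h : ¬ τ.Moves t p) :
    simStat τ (t + 1) p = simStat τ t p := Trace.status_succ_of_not_moves h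

/-! ### Unique tags and validity of views -/

/-- The process has already used the tag number `c`. -/
def TagUsed {L : Type u} (c : ℕ) : Status D (SimLocal n r W L) → Prop
  | .ready => False
  | .active (.run _ c') => c < c'
  | .active (.look _ c' _ _) => c < c'
  | .done _ => True

theorem SimStep.tagUsed {x x' : Fin r → TaggedCell n W}
    {st st' : Fin n → Status D (SimLocal n r W A.Local)} {e : Event n D}
    (h : SimStep A x st e x' st') {p : Fin n} {c : ℕ} (hp : TagUsed c (st p)) :
    TagUsed c (st' p) := by
  have key : ∀ q y, (p = q → TagUsed c y) → TagUsed c (Function.update st q y p) :=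
    fun q y hy => by
      by_cases hq : p = q
      · subst hq; rw [Function.update_self]; exact hy rfl
      · rw [Function.update_of_ne hq]; exact hp
  cases h with
  | invoke q v h => exact key _ _ (by rintro rfl; rw [h] at hp; exact hp.elim)
  | update q s c' i v cont h hs =>
    exact key _ _ (by rintro rfl; rw [h] at hp; exact Nat.lt_succ_of_lt hp)
  | start q s c' cont h hs => exact key _ _ (by rintro rfl; rw [h] at hp; exact hp)
  | compute q s c' s' h hs => exact key _ _ (by rintro rfl; rw [h] at hp; exact hp)
  | respond q s c' v h hs => exact key _ _ fun _ => trivial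
  | hit q s c' f j hj h hx => exact key _ _ (by rintro rfl; rw [h] at hp; exact hp)
  | miss q s c' f j hj h hx => exact key _ _ (by rintro rfl; rw [h] at hp; exact hp)
  | finish q s c' f j hj h => exact key _ _ (by rintro rfl; rw [h] at hp; exact hp)

theorem tagUsed_mono {a b : ℕ} (hab : a ≤ b) {p : Fin n} {c : ℕ}
    (h : TagUsed c (simStat τ a p)) : TagUsed c (simStat τ b p) := by
  induction b, hab using Nat.le_induction with
  | base => exact h
  | succ b _ ih =>
    rcases he : τ.event b with _ | e
    · rw [(sim_stutter he).2]; exact ih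
    · exact (sim_step he).tagUsed ih

/-- How a register can change in one step. -/
theorem regs_succ (τ : (simulate A).Trace) (t : ℕ) (i : Fin r) :
    regs τ (t + 1) i = regs τ t i ∨ ∃ p s c v, simStat τ t p = .active (.run s c) ∧
      regs τ (t + 1) i = (v, some (p, c)) ∧ TagUsed c (simStat τ (t + 1) p) := by
  rcases he : τ.event t with _ | e
  · exact .inl (congrFun (sim_stutter he).1 i)
  have hst := sim_step he
  generalize regs τ t = x, simStat τ t = st, regs τ (t + 1) = x', simStat τ (t + 1) = st' at *
  cases hst with
  | update q s c i' v cont h hs =>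
    by_cases hi : i = i'
    · subst hi
      refine .inr ⟨q, s, c, v, h, Function.update_self _ _ _, ?_⟩
      rw [Function.update_self]
      exact Nat.lt_succ_self c
    · exact .inl (Function.update_of_ne hi _ _)
  | _ => exact .inl rfl

theorem tagUsed_of_regs (t : ℕ) {i : Fin r} {p : Fin n} {c : ℕ}
    (h : (regs τ t i).2 = some (p, c)) : TagUsed c (simStat τ t p) := by
  induction t with
  | zero =>
    have : regs τ 0 i = (A.init i, none) := by
      rw [regs, Trace.mem_zero]; rfl
    rw [this] at h; cases h
  | succ t ih =>
    rcases regs_succ τ t i with h' | ⟨q, s, c', v, -, h', hu⟩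
    · rw [h'] at h
      exact tagUsed_mono t.le_succ (ih h)
    · rw [h'] at h
      cases h
      exact hu

/-- A register never returns to earlier contents. -/
theorem regs_eq_of_between {a t b : ℕ} (hat : a ≤ t) (htb : t ≤ b) {i : Fin r}
    (h : regs τ a i = regs τ b i) : regs τ t i = regs τ a i := by
  by_contra hne
  have : ∀ b ≥ t, regs τ b i ≠ regs τ a i := fun b hb => by
    induction b, hb using Nat.le_induction with
    | base => exact hne
    | succ b hb ih =>
      rcases regs_succ τ b i with h' | ⟨q, s, c, v, hq, h', -⟩
      · rwa [h']
      -- A return to the contents at time `a` would reuse the tag `(q, c)`, already used at time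
      -- `a`, although `q` still has write counter `c` at time `b`.
      · intro heq
        have htag : (regs τ a i).2 = some (q, c) := by rw [← heq, h']
        have hu := tagUsed_mono (hat.trans hb) (tagUsed_of_regs a htag)
        rw [hq] at hu
        exact lt_irrefl c hu
  exact this b htb h.symm

/-- A view consists of past register contents, and a scanning process is about to scan in the
simulated algorithm. -/
theorem look_valid (t : ℕ) {p : Fin n} {s : A.Local} {c : ℕ} {f : Fin r → TaggedCell n W} {j : ℕ}
    (h : simStat τ t p = .active (.look s c f j)) :
    (∀ i, ∃ a ≤ t, regs τ a i = f i) ∧ ∃ cont, A.next p s = .access .scan cont := by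
  induction t generalizing f j s c with
  | zero => rw [simStat, Trace.status_zero] at h; cases h
  | succ t ih =>
    have hlift : ∀ {f : Fin r → TaggedCell n W}, (∀ i, ∃ a ≤ t, regs τ a i = f i) →
        ∀ i, ∃ a ≤ t + 1, regs τ a i = f i := fun hf i => by
      obtain ⟨a, ha, hfa⟩ := hf i
      exact ⟨a, by omega, hfa⟩
    by_cases hm : τ.Moves t p
    swap
    · rw [simStat_succ_of_not_moves hm] at h
      exact ⟨hlift (ih h).1, (ih h).2⟩
    obtain ⟨e, he, rfl⟩ := hm
    have hst := sim_step he
    have hreg0 : ∀ i, regs τ 0 i = (A.init i, none) := fun i => by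
      rw [regs, Trace.mem_zero]; rfl
    generalize hx : regs τ t = x, hst0 : simStat τ t = st, hx' : regs τ (t + 1) = x',
      hst1 : simStat τ (t + 1) = st' at hst
    rw [hst1] at h
    cases hst with
    | invoke q v hq => rw [Event.proc, Function.update_self] at h; cases h
    | update q s c' i v cont hq hs => rw [Event.proc, Function.update_self] at h; cases h
    | start q s c' cont hq hs =>
      rw [Event.proc, Function.update_self] at h; cases h
      exact ⟨fun i => ⟨0, by omega, hreg0 i⟩, cont, hs⟩
    | compute q s c' s' hq hs => rw [Event.proc, Function.update_self] at h; cases h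
    | respond q s c' v hq hs => rw [Event.proc, Function.update_self] at h; cases h
    | hit q s c' f j hj hq hx =>
      rw [Event.proc, Function.update_self] at h; cases h
      have := ih ((congrFun hst0 q).trans hq)
      exact ⟨hlift this.1, this.2⟩
    | miss q s c' f j hj hq hne =>
      rw [Event.proc, Function.update_self] at h; cases h
      have := ih ((congrFun hst0 q).trans hq)
      refine ⟨fun i => ?_, this.2⟩
      by_cases hi : i = ⟨j, hj⟩
      · subst hi
        exact ⟨t, by omega, by rw [Function.update_self, hx]⟩
      · rw [Function.update_of_ne hi]
        exact hlift this.1 i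
    | finish q s c' f j hj hq => rw [Event.proc, Function.update_self] at h; cases h

/-- The condition on `j'` excludes a mismatch, which resets the counter to `0`. Otherwise the
counter advances only by reading a register that agrees with the view. -/
theorem look_succ {t : ℕ} {p : Fin n} {s : A.Local} {c : ℕ} {f : Fin r → TaggedCell n W}
    {j j' : ℕ} (h : simStat τ t p = .active (.look s c f j))
    (h' : simStat τ (t + 1) p = .active (.look s c f j')) (hj' : 1 ≤ j') :
    j' = j ∨ ∃ hj : j < r, j' = j + 1 ∧ regs τ t ⟨j, hj⟩ = f ⟨j, hj⟩ := by
  by_cases hm : τ.Moves t p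
  swap
  · rw [simStat_succ_of_not_moves hm, h] at h'
    cases h'
    exact .inl rfl
  obtain ⟨e, he, rfl⟩ := hm
  have hst := sim_step he
  generalize regs τ t = x, simStat τ t = st, regs τ (t + 1) = x', simStat τ (t + 1) = st' at *
  cases hst with
  | invoke q v hq => rw [Event.proc, hq] at h; cases h
  | update q s c' i v cont hq hs => rw [Event.proc, hq] at h; cases h
  | start q s c' cont hq hs => rw [Event.proc, hq] at h; cases h
  | compute q s c' s' hq hs => rw [Event.proc, hq] at h; cases h
  | respond q s c' v hq hs => rw [Event.proc, hq] at h; cases h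
  | hit q s c' f j hj hq hx =>
    rw [Event.proc, hq] at h; cases h
    rw [Event.proc, Function.update_self] at h'; cases h'
    exact .inr ⟨hj, rfl, hx⟩
  | miss q s c' f j hj hq hne =>
    rw [Event.proc, Function.update_self] at h'; cases h'
    omega
  | finish q s c' f j hj hq =>
    rw [Event.proc, Function.update_self] at h'; cases h'

/-! ### Linearization of successful scans -/

variable (τ) in
/-- The current pass of the scan of `p` has begun and will succeed with view `f`. -/
def Linearized (t : ℕ) (p : Fin n) (s : A.Local) (c : ℕ) (f : Fin r → TaggedCell n W) : Prop :=
  ∃ b ≥ t, (∀ t', t ≤ t' → t' ≤ b → ∃ j ≥ 1, simStat τ t' p = .active (.look s c f j)) ∧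
    ∃ j ≥ r, simStat τ b p = .active (.look s c f j)

theorem Linearized.exists_look {t : ℕ} {p : Fin n} {s : A.Local} {c : ℕ}
    {f : Fin r → TaggedCell n W} (h : Linearized τ t p s c f) :
    ∃ j ≥ 1, simStat τ t p = .active (.look s c f j) := by
  obtain ⟨b, hb, h, -⟩ := h
  exact h t le_rfl hb

theorem not_linearized_of_zero {t : ℕ} {p : Fin n} {s s' : A.Local} {c c' : ℕ}
    {f f' : Fin r → TaggedCell n W} (h : simStat τ t p = .active (.look s c f 0)) :
    ¬ Linearized τ t p s' c' f' := fun hl => by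
  obtain ⟨j, hj, h'⟩ := hl.exists_look
  rw [h] at h'
  cases h'
  omega

theorem Linearized.of_succ {t : ℕ} {p : Fin n} {s : A.Local} {c j : ℕ}
    {f : Fin r → TaggedCell n W} (hj : 1 ≤ j) (h : simStat τ t p = .active (.look s c f j))
    (hl : Linearized τ (t + 1) p s c f) : Linearized τ t p s c f := by
  obtain ⟨b, hb, h1, h2⟩ := hl
  refine ⟨b, by omega, fun t' ht' hb' => ?_, h2⟩
  rcases ht'.eq_or_lt with rfl | hlt
  · exact ⟨j, hj, h⟩
  · exact h1 t' hlt hb'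

theorem Linearized.succ {t : ℕ} {p : Fin n} {s : A.Local} {c j j' : ℕ}
    {f : Fin r → TaggedCell n W} (hj : j' = j ∨ j < r)
    (h : simStat τ t p = .active (.look s c f j))
    (h' : simStat τ (t + 1) p = .active (.look s c f j')) (hl : Linearized τ t p s c f) :
    Linearized τ (t + 1) p s c f := by
  obtain ⟨b, hb, h1, j₂, hj₂, h2⟩ := hl
  rcases hb.eq_or_lt with rfl | hlt
  · rw [h] at h2
    cases h2
    have hj' : j' = j := by omega
    subst hj'
    obtain ⟨j₃, hj₃, h3⟩ := h1 t le_rfl le_rfl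
    rw [h] at h3
    cases h3
    refine ⟨t + 1, le_rfl, fun t' ht' hb' => ?_, j', hj₂, h'⟩
    have : t' = t + 1 := by omega
    subst this
    exact ⟨j', hj₃, h'⟩
  · exact ⟨b, hlt, fun t' ht' hb' => h1 t' (by omega) hb', j₂, hj₂, h2⟩

theorem linearized_of_le (hr : 0 < r) {t : ℕ} {p : Fin n} {s : A.Local} {c j : ℕ}
    {f : Fin r → TaggedCell n W} (hj : r ≤ j) (h : simStat τ t p = .active (.look s c f j)) :
    Linearized τ t p s c f := by
  refine ⟨t, le_rfl, fun t' h1 h2 => ?_, j, hj, h⟩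
  have : t' = t := by omega
  subst this
  exact ⟨j, by omega, h⟩

/-- At the beginning of a successful pass the view is the current contents of the registers. -/
theorem regs_eq_view {t : ℕ} {p : Fin n} {s : A.Local} {c : ℕ} {f : Fin r → TaggedCell n W}
    (h : simStat τ t p = .active (.look s c f 0)) (hl : Linearized τ (t + 1) p s c f) :
    regs τ t = f := by
  obtain ⟨b, hb, h1, j₂, hj₂, h2⟩ := hl
  -- Every register confirmed so far agreed with the view when it was read, at some time not before
  -- `t`.
  have key : ∀ t' ≥ t, t' ≤ b → ∀ j, simStat τ t' p = .active (.look s c f j) →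
      ∀ i : Fin r, (i : ℕ) < j → ∃ d ≥ t, regs τ d i = f i := by
    intro t' ht'
    induction t', ht' using Nat.le_induction with
    | base =>
      intro _ j hj i hi
      rw [h] at hj
      cases hj
      omega
    | succ t' ht' ih =>
      intro hb' j hj i hi
      obtain ⟨j₀, h0⟩ : ∃ j₀, simStat τ t' p = .active (.look s c f j₀) := by
        rcases ht'.eq_or_lt with rfl | hlt
        · exact ⟨0, h⟩
        · obtain ⟨j₀, -, h0⟩ := h1 t' hlt (by omega)
          exact ⟨j₀, h0⟩
      obtain ⟨j₁, hj₁, h1'⟩ := h1 (t' + 1) (by omega) hb'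
      rw [hj] at h1'
      cases h1'
      rcases look_succ h0 hj hj₁ with rfl | ⟨hlt, rfl, hreg⟩
      · exact ih (by omega) _ h0 i hi
      · rcases Nat.lt_succ_iff_lt_or_eq.1 hi with hi | hi
        · exact ih (by omega) _ h0 i hi
        · have : i = ⟨j₀, hlt⟩ := Fin.ext hi
          subst this
          exact ⟨t', ht', hreg⟩
  funext i
  obtain ⟨d, hd, hdi⟩ := key b (by omega) le_rfl j₂ h2 i (i.isLt.trans_le hj₂)
  obtain ⟨a, ha, hai⟩ := (look_valid t h).1 i
  -- The register had the viewed contents at `a ≤ t` and at `d ≥ t`, and contents never recur, so it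
  -- had them at `t`.
  rw [regs_eq_of_between ha hd (hai.trans hdi.symm), hai]

variable (τ) in
open scoped Classical in
/-- The status of `p` in the simulated algorithm at time `t`. -/
noncomputable def absStatus (t : ℕ) (p : Fin n) : Status D A.Local :=
  match simStat τ t p with
  | .ready => .ready
  | .done v => .done v
  | .active (.run s _) => .active s
  | .active (.look s c f _) =>
    if Linearized τ t p s c f then .active (scanResult (A.next p s) (fun i => (f i).1) s)
    else .active s

variable (τ) in
/-- The configuration of the simulated algorithm at time `t`. -/
noncomputable def absConfig (t : ℕ) : A.Config where
  mem := fun i => (regs τ t i).1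
  status := absStatus τ t

section

variable {t : ℕ} {p : Fin n} {s : A.Local} {c j : ℕ} {f : Fin r → TaggedCell n W}

theorem absStatus_ready (h : simStat τ t p = .ready) : absStatus τ t p = .ready := by
  simp [absStatus, h]

theorem absStatus_done {v : D} (h : simStat τ t p = .done v) : absStatus τ t p = .done v := by
  simp [absStatus, h]

theorem absStatus_run (h : simStat τ t p = .active (.run s c)) :
    absStatus τ t p = .active s := by
  simp [absStatus, h]

theorem absStatus_look_pos (h : simStat τ t p = .active (.look s c f j))
    (hl : Linearized τ t p s c f) :
    absStatus τ t p = .active (scanResult (A.next p s) (fun i => (f i).1) s) := by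
  simp [absStatus, h, hl]

theorem absStatus_look_neg (h : simStat τ t p = .active (.look s c f j))
    (hl : ¬ Linearized τ t p s c f) : absStatus τ t p = .active s := by
  simp [absStatus, h, hl]

theorem linearized_succ_iff_of_not_moves (hm : ¬ τ.Moves t p)
    (h : simStat τ t p = .active (.look s c f j)) :
    Linearized τ (t + 1) p s c f ↔ Linearized τ t p s c f := by
  have h' := (simStat_succ_of_not_moves hm).trans h
  rcases Nat.eq_zero_or_pos j with rfl | hj
  · exact iff_of_false (not_linearized_of_zero h') (not_linearized_of_zero h)
  · exact ⟨.of_succ hj h, .succ (.inl rfl) h h'⟩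

/-- `Linearized` refers to the future of the trace, but its truth changes only by steps of `p`
itself. -/
theorem absStatus_succ_of_not_moves (hm : ¬ τ.Moves t p) :
    absStatus τ (t + 1) p = absStatus τ t p := by
  have heq := simStat_succ_of_not_moves hm
  rcases h : simStat τ t p with _ | (⟨s, c⟩ | ⟨s, c, f, j⟩) | v <;> rw [h] at heq
  · rw [absStatus_ready h, absStatus_ready heq]
  · rw [absStatus_run h, absStatus_run heq]
  · by_cases hl : Linearized τ t p s c f
    · rw [absStatus_look_pos h hl,
        absStatus_look_pos heq ((linearized_succ_iff_of_not_moves hm h).2 hl)]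
    · rw [absStatus_look_neg h hl,
        absStatus_look_neg heq (mt (linearized_succ_iff_of_not_moves hm h).1 hl)]
  · rw [absStatus_done h, absStatus_done heq]

theorem absStatus_succ {e : Event n D} (he : τ.event t = some e) :
    absStatus τ (t + 1) =
      Function.update (absStatus τ t) e.proc (absStatus τ (t + 1) e.proc) := by
  funext q
  by_cases hq : q = e.proc
  · subst hq; rw [Function.update_self]
  · rw [Function.update_of_ne hq]
    refine absStatus_succ_of_not_moves ?_
    rintro ⟨e', he', rfl⟩
    rw [he] at he'
    cases he'
    exact hq rfl

end

/-! ### Bounding the stuttering steps -/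

open scoped Classical in
/-- The number of registers whose contents differ from the view. -/
noncomputable def mismatches (x f : Fin r → TaggedCell n W) : ℕ :=
  (Finset.univ.filter fun i => f i ≠ x i).card

theorem mismatches_le (x f : Fin r → TaggedCell n W) : mismatches x f ≤ r := by
  classical
  exact (Finset.card_le_univ _).trans_eq (Fintype.card_fin r)

theorem mismatches_update_lt {x f : Fin r → TaggedCell n W} {i : Fin r} (h : x i ≠ f i) :
    mismatches x (Function.update f i (x i)) < mismatches x f := by
  classical
  refine Finset.card_lt_card ⟨fun a ha => ?_, fun hsub => ?_⟩
  · by_cases hai : a = i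
    · subst hai; simp at ha
    · simpa [Function.update_of_ne hai] using ha
  · have := hsub (Finset.mem_filter.2 ⟨Finset.mem_univ i, h.symm⟩)
    simp at this

variable (τ) in
open scoped Classical in
/-- A bound on the number of steps that `p` takes before its next step in the simulated algorithm
if the registers keep the contents `x`. -/
noncomputable def simRank (x : Fin r → TaggedCell n W) (t : ℕ) (p : Fin n) : ℕ :=
  match simStat τ t p with
  | .ready => 0
  | .done _ => 0
  | .active (.run _ _) => (r + 1) * (r + 1)
  | .active (.look s c f j) =>
    if Linearized τ t p s c f then (r + 1) * (r + 1) + 1 + (r - j)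
    else mismatches x f * (r + 1) + (r - j)

theorem simRank_run {x : Fin r → TaggedCell n W} {t : ℕ} {p : Fin n} {s : A.Local} {c : ℕ}
    (h : simStat τ t p = .active (.run s c)) : simRank τ x t p = (r + 1) * (r + 1) := by
  simp [simRank, h]

theorem simRank_look_pos {x f : Fin r → TaggedCell n W} {t : ℕ} {p : Fin n} {s : A.Local}
    {c j : ℕ} (h : simStat τ t p = .active (.look s c f j)) (hl : Linearized τ t p s c f) :
    simRank τ x t p = (r + 1) * (r + 1) + 1 + (r - j) := by
  simp [simRank, h, hl]

theorem simRank_look_neg {x f : Fin r → TaggedCell n W} {t : ℕ} {p : Fin n} {s : A.Local}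
    {c j : ℕ} (h : simStat τ t p = .active (.look s c f j)) (hl : ¬ Linearized τ t p s c f) :
    simRank τ x t p = mismatches x f * (r + 1) + (r - j) := by
  simp [simRank, h, hl]

theorem simRank_succ_of_not_moves {t : ℕ} {p : Fin n} (hm : ¬ τ.Moves t p)
    (x : Fin r → TaggedCell n W) : simRank τ x (t + 1) p = simRank τ x t p := by
  have heq := simStat_succ_of_not_moves hm
  rcases h : simStat τ t p with _ | (⟨s, c⟩ | ⟨s, c, f, j⟩) | v <;> rw [h] at heq
  · simp [simRank, h, heq]
  · simp [simRank, h, heq]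
  · by_cases hl : Linearized τ t p s c f
    · rw [simRank_look_pos h hl,
        simRank_look_pos heq ((linearized_succ_iff_of_not_moves hm h).2 hl)]
    · rw [simRank_look_neg h hl,
        simRank_look_neg heq (mt (linearized_succ_iff_of_not_moves hm h).1 hl)]
  · simp [simRank, h, heq]

/-- Each step of the simulation is a step of the simulated algorithm or a stuttering step. -/
theorem absConfig_step (hr : 0 < r) {t : ℕ} {e : Event n D} (he : τ.event t = some e) :
    A.Step (absConfig τ t) e (absConfig τ (t + 1)) ∨
      (absConfig τ (t + 1) = absConfig τ t ∧ e = .internal e.proc ∧ regs τ (t + 1) = regs τ t ∧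
        simRank τ (regs τ t) (t + 1) e.proc < simRank τ (regs τ t) t e.proc) := by
  have hst := sim_step he
  have hsucc := absStatus_succ he
  have hcfg : absConfig τ (t + 1) = ⟨fun i => (regs τ (t + 1) i).1, Function.update (absStatus τ t)
      e.proc (absStatus τ (t + 1) e.proc)⟩ := by
    rw [← hsucc]; rfl
  have hstutter : regs τ (t + 1) = regs τ t → absStatus τ (t + 1) e.proc = absStatus τ t e.proc →
      absConfig τ (t + 1) = absConfig τ t := fun h1 h2 => by
    rw [hcfg, h1, h2, Function.update_eq_self]; rfl
  rw [hcfg]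
  rw [hcfg] at hstutter
  generalize hx : regs τ t = x, hx' : regs τ (t + 1) = x', hs0 : simStat τ t = st,
    hs1 : simStat τ (t + 1) = st' at hst hstutter ⊢
  have hmem : (absConfig τ t).mem = fun i => (x i).1 := by rw [← hx]; rfl
  cases hst with
  | invoke p v hp =>
    left
    have h1 : simStat τ (t + 1) p = .active (.run (A.start p v) 0) := by
      rw [hs1, Function.update_self]
    rw [Event.proc, absStatus_run h1, ← hmem]
    exact .invoke (absConfig τ t) p v (absStatus_ready ((congrFun hs0 p).trans hp))
  | update p s c i v cont hp hs =>
    left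
    have h1 : simStat τ (t + 1) p = .active (.run (cont PUnit.unit) (c + 1)) := by
      rw [hs1, Function.update_self]
    rw [Event.proc, absStatus_run h1]
    have hupd : (fun i' => (Function.update x i (v, some (p, c)) i').1) =
        Function.update (fun i' => (x i').1) i v := by
      funext i'
      by_cases hi : i' = i
      · subst hi; simp
      · simp [Function.update_of_ne hi]
    rw [hupd, ← hx]
    exact Step.access (A := A) (absConfig τ t) p s (.update i v) cont
      (absStatus_run ((congrFun hs0 p).trans hp)) hs
  | start p s c cont hp hs =>
    right
    have h0 := (congrFun hs0 p).trans hp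
    have h1 : simStat τ (t + 1) p = .active (.look s c (fun i => (A.init i, none)) 0) := by
      rw [hs1, Function.update_self]
    have hnl := not_linearized_of_zero (s' := s) (c' := c) (f' := fun i => (A.init i, none)) h1
    refine ⟨hstutter rfl ?_, rfl, rfl, ?_⟩
    · rw [Event.proc, absStatus_run h0, absStatus_look_neg h1 hnl]
    -- A fresh view has rank at most `r * (r + 1) + r`, just below the rank `(r + 1) * (r + 1)` of a
    -- process not scanning.
    · have := Nat.mul_le_mul_right (r + 1) (mismatches_le x (fun i => (A.init i, none)))
      rw [Event.proc, simRank_run h0, simRank_look_neg h1 hnl]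
      rw [Nat.sub_zero, Nat.succ_mul r (r + 1)]
      omega
  | compute p s c s' hp hs =>
    left
    have h1 : simStat τ (t + 1) p = .active (.run s' c) := by
      rw [hs1, Function.update_self]
    rw [Event.proc, absStatus_run h1, ← hmem]
    exact .compute (absConfig τ t) p s s' (absStatus_run ((congrFun hs0 p).trans hp)) hs
  | respond p s c v hp hs =>
    left
    have h1 : simStat τ (t + 1) p = .done v := by
      rw [hs1, Function.update_self]
    rw [Event.proc, absStatus_done h1, ← hmem]
    exact .respond (absConfig τ t) p s v (absStatus_run ((congrFun hs0 p).trans hp)) hs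
  | hit p s c f j hj hp hxj =>
    have h0 := (congrFun hs0 p).trans hp
    have h1 : simStat τ (t + 1) p = .active (.look s c f (j + 1)) := by
      rw [hs1, Function.update_self]
    by_cases hl1 : Linearized τ (t + 1) p s c f
    · rcases Nat.eq_zero_or_pos j with rfl | hjpos
      -- The first read of a successful pass is the linearization point: the view equals the current
      -- memory, and the simulated process scans now.
      · left
        obtain ⟨-, cont, hcont⟩ := look_valid t h0
        have hview := regs_eq_view h0 hl1
        have hres : scanResult (A.next p s) (fun i => (f i).1) s = cont (absConfig τ t).mem := by
          rw [hcont, ← hview]; rfl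
        rw [Event.proc, absStatus_look_pos h1 hl1, ← hmem, hres]
        exact Step.access (A := A) (absConfig τ t) p s .scan cont
          (absStatus_look_neg h0 (not_linearized_of_zero h0)) hcont
      · right
        have hl0 := hl1.of_succ hjpos h0
        refine ⟨hstutter rfl ?_, rfl, rfl, ?_⟩
        · rw [Event.proc, absStatus_look_pos h0 hl0, absStatus_look_pos h1 hl1]
        · rw [Event.proc, simRank_look_pos h0 hl0, simRank_look_pos h1 hl1]
          omega
    · right
      have hl0 : ¬ Linearized τ t p s c f := fun hl0 => hl1 (hl0.succ (.inr hj) h0 h1)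
      refine ⟨hstutter rfl ?_, rfl, rfl, ?_⟩
      · rw [Event.proc, absStatus_look_neg h0 hl0, absStatus_look_neg h1 hl1]
      · rw [Event.proc, simRank_look_neg h0 hl0, simRank_look_neg h1 hl1]
        omega
  | miss p s c f j hj hp hne =>
    right
    have h0 := (congrFun hs0 p).trans hp
    have h1 : simStat τ (t + 1) p =
        .active (.look s c (Function.update f ⟨j, hj⟩ (x ⟨j, hj⟩)) 0) := by
      rw [hs1, Function.update_self]
    have hl1 := not_linearized_of_zero (s' := s) (c' := c)
      (f' := Function.update f ⟨j, hj⟩ (x ⟨j, hj⟩)) h1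
    -- The mismatch resets the counter to `0`, so the current pass cannot be the successful one.
    have hl0 : ¬ Linearized τ t p s c f := by
      rintro ⟨b, hb, hall, j₂, hj₂, h2⟩
      rcases hb.eq_or_lt with rfl | hlt
      · rw [h0] at h2
        cases h2
        omega
      · obtain ⟨j₃, hj₃, h3⟩ := hall (t + 1) (by omega) hlt
        rw [h1] at h3
        injection h3 with h3
        injection h3
        omega
    refine ⟨hstutter rfl ?_, rfl, rfl, ?_⟩
    · rw [Event.proc, absStatus_look_neg h0 hl0, absStatus_look_neg h1 hl1]
    · have := Nat.mul_le_mul_right (r + 1) (Nat.succ_le_of_lt (mismatches_update_lt hne))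
      rw [Nat.succ_mul] at this
      rw [Event.proc, simRank_look_neg h0 hl0, simRank_look_neg h1 hl1]
      omega
  | finish p s c f j hj hp =>
    right
    have h0 := (congrFun hs0 p).trans hp
    have h1 : simStat τ (t + 1) p =
        .active (.run (scanResult (A.next p s) (fun i => (f i).1) s) c) := by
      rw [hs1, Function.update_self]
    have hl0 := linearized_of_le hr hj h0
    refine ⟨hstutter rfl ?_, rfl, rfl, ?_⟩
    · rw [Event.proc, absStatus_look_pos h0 hl0, absStatus_run h1]
    · rw [Event.proc, simRank_look_pos h0 hl0, simRank_run h1]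
      omega

open scoped Classical in
variable (τ) in
/-- The trace of the simulated algorithm. -/
noncomputable def absTrace (hr : 0 < r) : A.Trace where
  config t := absConfig τ t
  -- Steps that do not act on the simulated configuration become stuttering, and time is unchanged.
  event t := (τ.event t).filter fun e => A.Step (absConfig τ t) e (absConfig τ (t + 1))
  start_eq := by
    rw [absConfig, initial]
    congr 1
    · funext i
      rw [regs, Trace.mem_zero]; rfl
    · funext p
      exact absStatus_ready (Trace.status_zero p)
  step_some t e he := by
    rw [Option.filter_eq_some_iff] at he
    exact of_decide_eq_true he.2
  step_none t he := by
    rcases hev : τ.event t with _ | e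
    · rw [absConfig, absConfig, (sim_stutter hev).1]
      congr 1
      funext p
      refine absStatus_succ_of_not_moves ?_
      rintro ⟨e, he, -⟩
      rw [hev] at he; cases he
    · rcases absConfig_step hr hev with h | h
      · rw [hev] at he
        simp [Option.filter, h] at he
      · exact h.1

theorem absTrace_event {hr : 0 < r} {t : ℕ} {e : Event n D} :
    (absTrace τ hr).event t = some e ↔
      τ.event t = some e ∧ A.Step (absConfig τ t) e (absConfig τ (t + 1)) := by
  simp [absTrace, Option.filter_eq_some_iff]

theorem Algorithm.TraceSolves.simulate {k : ℕ} (hr : 0 < r) (h : A.TraceSolves k) :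
    (simulate A).TraceSolves k := by
  intro τ
  -- Only internal events are dropped, so inputs and outputs of the two traces coincide.
  have hev : ∀ t e, e ≠ .internal e.proc →
      ((absTrace τ hr).event t = some e ↔ τ.event t = some e) := fun t e hne => by
    rw [absTrace_event]
    refine ⟨And.left, fun he => ⟨he, (absConfig_step hr he).resolve_right fun h' => hne h'.2.1⟩⟩
  have hin : (absTrace τ hr).inputs = τ.inputs := by
    ext v
    exact exists_congr fun t => exists_congr fun p => hev t _ (by simp)
  have hout : (absTrace τ hr).outputs = τ.outputs := by
    ext v
    exact exists_congr fun t => exists_congr fun p => hev t _ (by simp)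
  rw [← hin, ← hout]
  exact h _

/-- The simulated trace has no more live processes than the simulation, hence none at all. From some
time on all steps are stuttering steps, which keep the registers fixed and decrease the rank, so
there are finitely many. -/
theorem Algorithm.TraceTerminates.simulate {m : ℕ} (hr : 0 < r) (h : A.TraceTerminates m) :
    (simulate A).TraceTerminates m := by
  intro τ hcard p
  have hmoves : ∀ t q, (absTrace τ hr).Moves t q → τ.Moves t q := by
    rintro t q ⟨e, he, hq⟩
    exact ⟨e, (absTrace_event.1 he).1, hq⟩
  have hlive : {q | (absTrace τ hr).Live q} ⊆ {q | τ.Live q} := fun q hq =>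
    Set.Infinite.mono (fun t => hmoves t q) hq
  have hnone := h (absTrace τ hr) ((Set.encard_le_encard hlive).trans hcard)
  obtain ⟨T, hT⟩ := (absTrace τ hr).exists_forall_live
  have hstut : ∀ t ≥ T, ∀ e, τ.event t = some e → regs τ (t + 1) = regs τ t ∧
      simRank τ (regs τ t) (t + 1) e.proc < simRank τ (regs τ t) t e.proc := by
    intro t ht e he
    rcases absConfig_step hr he with h' | h'
    · exact absurd (hT t ht e.proc ⟨e, absTrace_event.2 ⟨he, h'⟩, rfl⟩) (hnone _)
    · exact h'.2.2
  have hregs : ∀ t ≥ T, regs τ t = regs τ T := fun t ht => by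
    induction t, ht using Nat.le_induction with
    | base => rfl
    | succ t ht ih =>
      rcases he : τ.event t with _ | e
      · rw [(sim_stutter he).1, ih]
      · rw [(hstut t ht e he).1, ih]
  have hlt : ∀ t ≥ T, τ.Moves t p →
      simRank τ (regs τ T) (t + 1) p < simRank τ (regs τ T) t p := by
    rintro t ht ⟨e, he, rfl⟩
    have := (hstut t ht e he).2
    rwa [hregs t ht] at this
  refine Trace.not_live_of_rank (fun t => simRank τ (regs τ T) t p) T (fun t ht => ?_) hlt
  by_cases hm : τ.Moves t p
  · exact (hlt t ht hm).le
  · exact (simRank_succ_of_not_moves hm _).le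

end Simulation

/-! ### The voting algorithm with one component per process -/

section Converge

/-- What a process has written so far: for each round its value and its vote, a value with a flag
that tells whether few values were seen. -/
structure History (D : Type u) : Type u where
  first : ℕ → Option D
  second : ℕ → Option (D × Bool)

variable {n m : ℕ} {D : Type u}

/-- The history without entries. -/
def History.empty : History D := ⟨fun _ => none, fun _ => none⟩

/-- Add the value of round `ρ`. -/
def History.setFirst (h : History D) (ρ : ℕ) (v : D) : History D :=
  ⟨Function.update h.first ρ (some v), h.second⟩

/-- Add the vote of round `ρ`. -/
def History.setSecond (h : History D) (ρ : ℕ) (x : D × Bool) : History D :=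
  ⟨h.first, Function.update h.second ρ (some x)⟩

/-- Local states of the converge algorithm, with own history, round and value. -/
inductive ConvergeLocal (D : Type u) : Type u where
  | propose (h : History D) (ρ : ℕ) (v : D)
  | look (h : History D) (ρ : ℕ) (v : D)
  | vote (h : History D) (ρ : ℕ) (v : D) (b : Bool)
  | check (h : History D) (ρ : ℕ) (v : D)
  | output (v : D)

/-- The values of round `ρ` in a scan. -/
def roundValues (s : Fin n → History D) (ρ : ℕ) : Set D := {w | ∃ q, (s q).first ρ = some w}

open scoped Classical in
/-- The flag of a vote: at most `m` values of the round were seen. -/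
noncomputable def fewValues (m : ℕ) (s : Fin n → History D) (ρ : ℕ) : Bool :=
  decide ((roundValues s ρ).encard ≤ m)

open scoped Classical in
/-- If all votes of the round have their flags set, output; otherwise go to the next round, with
the value of a vote that has its flag set if there is one. -/
noncomputable def afterCheck (h : History D) (ρ : ℕ) (v : D) (s : Fin n → History D) :
    ConvergeLocal D :=
  if ∀ q w, (s q).second ρ ≠ some (w, false) then .output v
  else if hex : ∃ w q, (s q).second ρ = some (w, true) then .propose h (ρ + 1) hex.choose
  else .propose h (ρ + 1) v

/-- Set agreement by rounds of voting, on a snapshot object with one component per process. -/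
noncomputable def converge (n m : ℕ) (D : Type u) : Algorithm (snapshot n (History D)) n D where
  Local := ConvergeLocal D
  init := fun _ => .empty
  start := fun _ v => .propose .empty 0 v
  next := fun p l => match l with
    | .propose h ρ v => .access (.update p (h.setFirst ρ v)) fun _ => .look (h.setFirst ρ v) ρ v
    | .look h ρ v => .access .scan fun s => .vote h ρ v (fewValues m s ρ)
    | .vote h ρ v b => .access (.update p (h.setSecond ρ (v, b))) fun _ =>
        .check (h.setSecond ρ (v, b)) ρ v
    | .check h ρ v => .access .scan fun s => afterCheck h ρ v s
    | .output v => .respond v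

theorem afterCheck_cases (h : History D) (ρ : ℕ) (v : D) (s : Fin n → History D) :
    ((∀ q w, (s q).second ρ ≠ some (w, false)) ∧ afterCheck h ρ v s = .output v) ∨
    (¬ (∀ q w, (s q).second ρ ≠ some (w, false)) ∧ ∃ w q, (s q).second ρ = some (w, true) ∧
      afterCheck h ρ v s = .propose h (ρ + 1) w) ∨
    (¬ (∀ q w, (s q).second ρ ≠ some (w, false)) ∧ (¬ ∃ w q, (s q).second ρ = some (w, true)) ∧
      afterCheck h ρ v s = .propose h (ρ + 1) v) := by
  by_cases h₁ : ∀ q w, (s q).second ρ ≠ some (w, false)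
  · exact .inl ⟨h₁, if_pos h₁⟩
  · by_cases h₂ : ∃ w q, (s q).second ρ = some (w, true)
    · obtain ⟨q, hq⟩ := h₂.choose_spec
      exact .inr (.inl ⟨h₁, h₂.choose, q, hq, (if_neg h₁).trans (dif_pos h₂)⟩)
    · exact .inr (.inr ⟨h₁, h₂, (if_neg h₁).trans (dif_neg h₂)⟩)

/-- The steps of the converge algorithm, on contents of the snapshot object and statuses. -/
inductive ConvergeStep (m : ℕ) :
    (Fin n → History D) → (Fin n → Status D (ConvergeLocal D)) → Event n D →
    (Fin n → History D) → (Fin n → Status D (ConvergeLocal D)) → Prop where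
  | invoke (s st p v) (hp : st p = .ready) :
      ConvergeStep m s st (.invoke p v) s
        (Function.update st p (.active (.propose .empty 0 v)))
  | propose (s st p h ρ v) (hp : st p = .active (.propose h ρ v)) :
      ConvergeStep m s st (.internal p) (Function.update s p (h.setFirst ρ v))
        (Function.update st p (.active (.look (h.setFirst ρ v) ρ v)))
  | look (s st p h ρ v) (hp : st p = .active (.look h ρ v)) :
      ConvergeStep m s st (.internal p) s
        (Function.update st p (.active (.vote h ρ v (fewValues m s ρ))))
  | vote (s st p h ρ v b) (hp : st p = .active (.vote h ρ v b)) :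
      ConvergeStep m s st (.internal p) (Function.update s p (h.setSecond ρ (v, b)))
        (Function.update st p (.active (.check (h.setSecond ρ (v, b)) ρ v)))
  | check (s st p h ρ v) (hp : st p = .active (.check h ρ v)) :
      ConvergeStep m s st (.internal p) s
        (Function.update st p (.active (afterCheck h ρ v s)))
  | respond (s st p v) (hp : st p = .active (.output v)) :
      ConvergeStep m s st (.respond p v) s (Function.update st p (.done v))

theorem converge_step {c c' : (converge n m D).Config} {e : Event n D}
    (h : (converge n m D).Step c e c') :
    ConvergeStep m c.mem c.status e c'.mem c'.status := by
  cases h with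
  | invoke p v h => exact .invoke _ _ p v h
  | access p l o cont h hs =>
    cases l with
    | propose g ρ v => cases hs; exact .propose _ _ p g ρ v h
    | look g ρ v => cases hs; exact .look _ _ p g ρ v h
    | vote g ρ v b => cases hs; exact .vote _ _ p g ρ v b h
    | check g ρ v => cases hs; exact .check _ _ p g ρ v h
    | output v => cases hs
  | compute p l l' h hs => cases l <;> cases hs
  | respond p l v h hs =>
    cases l with
    | output v => cases hs; exact .respond _ _ p _ h
    | _ => cases hs

/-- What the history of a process looks like, by its status. -/
def OwnHistory (g : History D) : Status D (ConvergeLocal D) → Prop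
  | .ready => g = .empty
  | .active (.propose h ρ _) => g = h ∧ ∀ σ ≥ ρ, g.first σ = none ∧ g.second σ = none
  | .active (.look h ρ v) => g = h ∧ g.first ρ = some v ∧ (∀ σ > ρ, g.first σ = none) ∧
      ∀ σ ≥ ρ, g.second σ = none
  | .active (.vote h ρ v _) => g = h ∧ g.first ρ = some v ∧ (∀ σ > ρ, g.first σ = none) ∧
      ∀ σ ≥ ρ, g.second σ = none
  | .active (.check h ρ v) => g = h ∧ (∃ b, g.second ρ = some (v, b)) ∧
      ∀ σ > ρ, g.first σ = none ∧ g.second σ = none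
  | .active (.output _) => ∃ ρ, ∀ σ > ρ, g.first σ = none ∧ g.second σ = none
  | .done _ => ∃ ρ, ∀ σ > ρ, g.first σ = none ∧ g.second σ = none

theorem OwnHistory.exists_bound {g : History D} {x : Status D (ConvergeLocal D)}
    (h : OwnHistory g x) : ∃ ρ, ∀ σ > ρ, g.first σ = none ∧ g.second σ = none := by
  rcases x with _ | (⟨g', ρ, v⟩ | ⟨g', ρ, v⟩ | ⟨g', ρ, v, b⟩ | ⟨g', ρ, v⟩ | v) | v
  · exact ⟨0, fun σ _ => by rw [show g = .empty from h]; exact ⟨rfl, rfl⟩⟩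
  · exact ⟨ρ, fun σ hσ => h.2 σ (le_of_lt hσ)⟩
  · exact ⟨ρ, fun σ hσ => ⟨h.2.2.1 σ hσ, h.2.2.2 σ (le_of_lt hσ)⟩⟩
  · exact ⟨ρ, fun σ hσ => ⟨h.2.2.1 σ hσ, h.2.2.2 σ (le_of_lt hσ)⟩⟩
  · exact ⟨ρ, h.2.2⟩
  · exact h
  · exact h

theorem ConvergeStep.ownHistory {s s' : Fin n → History D}
    {st st' : Fin n → Status D (ConvergeLocal D)} {e : Event n D}
    (h : ConvergeStep m s st e s' st') (hown : ∀ p, OwnHistory (s p) (st p)) (p : Fin n) :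
    OwnHistory (s' p) (st' p) := by
  have hp := hown p
  cases h with
  | invoke q v hq =>
    by_cases hpq : p = q
    · subst hpq
      rw [hq] at hp
      rw [Function.update_self]
      refine ⟨hp, fun σ _ => ?_⟩
      rw [show s p = .empty from hp]
      exact ⟨rfl, rfl⟩
    · rwa [Function.update_of_ne hpq]
  | propose q g ρ v hq =>
    by_cases hpq : p = q
    · subst hpq
      rw [hq] at hp
      rw [Function.update_self, Function.update_self]
      obtain ⟨rfl, hp⟩ := hp
      refine ⟨rfl, Function.update_self _ _ _, fun σ hσ => ?_, fun σ hσ => (hp σ hσ).2⟩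
      exact (Function.update_of_ne (ne_of_gt hσ) _ _).trans (hp σ (le_of_lt hσ)).1
    · rwa [Function.update_of_ne hpq, Function.update_of_ne hpq]
  | look q g ρ v hq =>
    by_cases hpq : p = q
    · subst hpq
      rw [hq] at hp
      rw [Function.update_self]
      exact hp
    · rwa [Function.update_of_ne hpq]
  | vote q g ρ v b hq =>
    by_cases hpq : p = q
    · subst hpq
      rw [hq] at hp
      rw [Function.update_self, Function.update_self]
      obtain ⟨rfl, -, h1, h2⟩ := hp
      refine ⟨rfl, ⟨b, Function.update_self _ _ _⟩, fun σ hσ => ⟨h1 σ hσ, ?_⟩⟩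
      exact (Function.update_of_ne (ne_of_gt hσ) _ _).trans (h2 σ (le_of_lt hσ))
    · rwa [Function.update_of_ne hpq, Function.update_of_ne hpq]
  | check q g ρ v hq =>
    by_cases hpq : p = q
    · subst hpq
      rw [hq] at hp
      rw [Function.update_self]
      rcases afterCheck_cases g ρ v s with ⟨-, h'⟩ | ⟨-, w, -, -, h'⟩ | ⟨-, -, h'⟩ <;> rw [h']
      · exact ⟨ρ, hp.2.2⟩
      · exact ⟨hp.1, fun σ hσ => hp.2.2 σ hσ⟩
      · exact ⟨hp.1, fun σ hσ => hp.2.2 σ hσ⟩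
    · rwa [Function.update_of_ne hpq]
  | respond q v hq =>
    by_cases hpq : p = q
    · subst hpq
      rw [hq] at hp
      rw [Function.update_self]
      exact hp
    · rwa [Function.update_of_ne hpq]

/-- Every entry is written at most once: `OwnHistory` says that it is still empty when its turn
comes. -/
theorem ConvergeStep.entry_mono {s s' : Fin n → History D}
    {st st' : Fin n → Status D (ConvergeLocal D)} {e : Event n D}
    (h : ConvergeStep m s st e s' st') (hown : ∀ p, OwnHistory (s p) (st p)) (p : Fin n) (σ : ℕ) :
    (∀ v, (s p).first σ = some v → (s' p).first σ = some v) ∧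
      ∀ x, (s p).second σ = some x → (s' p).second σ = some x := by
  have hp := hown p
  cases h with
  | propose q g ρ v hq =>
    by_cases hpq : p = q
    · subst hpq
      rw [hq] at hp
      rw [Function.update_self]
      obtain ⟨rfl, hp⟩ := hp
      refine ⟨fun w hw => ?_, fun x hx => hx⟩
      have hσ : σ ≠ ρ := by
        rintro rfl
        rw [(hp σ le_rfl).1] at hw
        cases hw
      exact (Function.update_of_ne hσ _ _).trans hw
    · rw [Function.update_of_ne hpq]
      exact ⟨fun _ => id, fun _ => id⟩
  | vote q g ρ v b hq =>
    by_cases hpq : p = q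
    · subst hpq
      rw [hq] at hp
      rw [Function.update_self]
      obtain ⟨rfl, -, -, h2⟩ := hp
      refine ⟨fun w hw => hw, fun x hx => ?_⟩
      have hσ : σ ≠ ρ := by
        rintro rfl
        rw [h2 σ le_rfl] at hx
        cases hx
      exact (Function.update_of_ne hσ _ _).trans hx
    · rw [Function.update_of_ne hpq]
      exact ⟨fun _ => id, fun _ => id⟩
  | _ => exact ⟨fun _ => id, fun _ => id⟩

variable (τ : (converge n m D).Trace)

/-- The histories at time `t`. -/
noncomputable def hist (t : ℕ) : Fin n → History D := τ.mem t

/-- The statuses at time `t`. -/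
noncomputable def convStat (t : ℕ) : Fin n → Status D (ConvergeLocal D) := τ.status t

variable {τ}

theorem conv_step {t : ℕ} {e : Event n D} (h : τ.event t = some e) :
    ConvergeStep m (hist τ t) (convStat τ t) e (hist τ (t + 1)) (convStat τ (t + 1)) :=
  converge_step (τ.step_some t e h)

theorem conv_stutter {t : ℕ} (h : τ.event t = none) :
    hist τ (t + 1) = hist τ t ∧ convStat τ (t + 1) = convStat τ t := by
  have := τ.step_none t h
  exact ⟨congrArg Config.mem this, congrArg Config.status this⟩

theorem hist_zero (p : Fin n) : hist τ 0 p = .empty := by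
  rw [hist, Trace.mem_zero]; rfl

theorem convStat_zero (p : Fin n) : convStat τ 0 p = .ready := Trace.status_zero p

/-- Induction along a trace of the converge algorithm. -/
theorem conv_induction {P : (Fin n → History D) → (Fin n → Status D (ConvergeLocal D)) → Prop}
    (h0 : P (hist τ 0) (convStat τ 0))
    (hs : ∀ t e, τ.event t = some e → P (hist τ t) (convStat τ t) →
      P (hist τ (t + 1)) (convStat τ (t + 1))) (t : ℕ) : P (hist τ t) (convStat τ t) := by
  induction t with
  | zero => exact h0
  | succ t ih =>
    rcases he : τ.event t with _ | e
    · rw [(conv_stutter he).1, (conv_stutter he).2]; exact ih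
    · exact hs t e he ih

theorem trace_ownHistory (t : ℕ) (p : Fin n) : OwnHistory (hist τ t p) (convStat τ t p) := by
  refine conv_induction (P := fun s st => ∀ p, OwnHistory (s p) (st p)) (fun p => ?_)
    (fun t e he ih => (conv_step he).ownHistory ih) t p
  rw [convStat_zero]
  exact hist_zero p

theorem hist_mono {a b : ℕ} (hab : a ≤ b) (p : Fin n) (σ : ℕ) :
    (∀ v, (hist τ a p).first σ = some v → (hist τ b p).first σ = some v) ∧
      ∀ x, (hist τ a p).second σ = some x → (hist τ b p).second σ = some x := by
  induction b, hab using Nat.le_induction with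
  | base => exact ⟨fun _ => id, fun _ => id⟩
  | succ b hb ih =>
    rcases he : τ.event b with _ | e
    · rw [(conv_stutter he).1]; exact ih
    · have := (conv_step he).entry_mono (trace_ownHistory b) p σ
      exact ⟨fun v hv => this.1 v (ih.1 v hv), fun x hx => this.2 x (ih.2 x hx)⟩

theorem roundValues_mono {a b : ℕ} (hab : a ≤ b) (σ : ℕ) :
    roundValues (hist τ a) σ ⊆ roundValues (hist τ b) σ := fun w ⟨q, hq⟩ =>
  ⟨q, (hist_mono hab q σ).1 w hq⟩

/-- The moves of one process of the converge algorithm, when the histories are `s` and all inputs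
are in `V`. -/
inductive ConvergeMove (m : ℕ) (V : Set D) (s : Fin n → History D) :
    Status D (ConvergeLocal D) → Status D (ConvergeLocal D) → Prop where
  | invoke (v) (hv : v ∈ V) : ConvergeMove m V s .ready (.active (.propose .empty 0 v))
  | propose (h ρ v) : ConvergeMove m V s (.active (.propose h ρ v))
      (.active (.look (h.setFirst ρ v) ρ v))
  | look (h ρ v) : ConvergeMove m V s (.active (.look h ρ v))
      (.active (.vote h ρ v (fewValues m s ρ)))
  | vote (h ρ v b) : ConvergeMove m V s (.active (.vote h ρ v b))
      (.active (.check (h.setSecond ρ (v, b)) ρ v))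
  | decide (h ρ v) (hs : ∀ q w, (s q).second ρ ≠ some (w, false)) :
      ConvergeMove m V s (.active (.check h ρ v)) (.active (.output v))
  | adopt (h ρ v w q) (hq : (s q).second ρ = some (w, true))
      (hs : ¬ ∀ q w, (s q).second ρ ≠ some (w, false)) :
      ConvergeMove m V s (.active (.check h ρ v)) (.active (.propose h (ρ + 1) w))
  | keep (h ρ v) (hn : ¬ ∃ w q, (s q).second ρ = some (w, true))
      (hs : ¬ ∀ q w, (s q).second ρ ≠ some (w, false)) :
      ConvergeMove m V s (.active (.check h ρ v)) (.active (.propose h (ρ + 1) v))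
  | respond (v) : ConvergeMove m V s (.active (.output v)) (.done v)

theorem conv_move {t : ℕ} {p : Fin n} (hm : τ.Moves t p) :
    ConvergeMove m τ.inputs (hist τ t) (convStat τ t p) (convStat τ (t + 1) p) := by
  obtain ⟨e, he, rfl⟩ := hm
  have hst := conv_step he
  generalize hist τ t = s, convStat τ t = st, hist τ (t + 1) = s', convStat τ (t + 1) = st' at *
  cases hst with
  | invoke q v hq =>
    rw [Event.proc, hq, Function.update_self]
    exact .invoke v ⟨t, q, he⟩
  | propose q h ρ v hq => rw [Event.proc, hq, Function.update_self]; exact .propose h ρ v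
  | look q h ρ v hq => rw [Event.proc, hq, Function.update_self]; exact .look h ρ v
  | vote q h ρ v b hq => rw [Event.proc, hq, Function.update_self]; exact .vote h ρ v b
  | check q h ρ v hq =>
    rw [Event.proc, hq, Function.update_self]
    rcases afterCheck_cases h ρ v s with ⟨h1, h'⟩ | ⟨h1, w, q', h2, h'⟩ | ⟨h1, h2, h'⟩ <;> rw [h']
    · exact .decide h ρ v h1
    · exact .adopt h ρ v w q' h2 h1
    · exact .keep h ρ v h2 h1
  | respond q v hq => rw [Event.proc, hq, Function.update_self]; exact .respond v

/-- Prove an invariant of statuses at time `t + 1` from time `t`. -/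
theorem conv_succ {t : ℕ} {p : Fin n} {Q : Status D (ConvergeLocal D) → Prop}
    (h : Q (convStat τ t p)) (hs : ∀ x y, convStat τ t p = x → Q x →
      ConvergeMove m τ.inputs (hist τ t) x y → Q y) : Q (convStat τ (t + 1) p) := by
  by_cases hm : τ.Moves t p
  · exact hs _ _ rfl h (conv_move hm)
  · rw [show convStat τ (t + 1) p = convStat τ t p from Trace.status_succ_of_not_moves hm]
    exact h

/-- A vote that is new at time `t + 1` was cast at time `t`. -/
theorem second_succ {t : ℕ} {p : Fin n} {σ : ℕ} {v : D} {b : Bool}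
    (h : (hist τ (t + 1) p).second σ = some (v, b)) :
    (hist τ t p).second σ = some (v, b) ∨ ∃ g, convStat τ t p = .active (.vote g σ v b) := by
  rcases he : τ.event t with _ | e
  · rw [(conv_stutter he).1] at h
    exact .inl h
  have hst := conv_step he
  have hown := trace_ownHistory (τ := τ) t p
  generalize hist τ t = s, convStat τ t = st, hist τ (t + 1) = s', convStat τ (t + 1) = st' at *
  cases hst with
  | propose q g ρ w hq =>
    by_cases hpq : p = q
    · subst hpq
      rw [hq] at hown
      rw [Function.update_self, ← hown.1] at h
      exact .inl h
    · rw [Function.update_of_ne hpq] at h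
      exact .inl h
  | vote q g ρ w b' hq =>
    by_cases hpq : p = q
    · subst hpq
      rw [hq] at hown
      rw [Function.update_self, ← hown.1] at h
      by_cases hσ : σ = ρ
      · subst hσ
        have h' : some (w, b') = some (v, b) := by
          simpa [History.setSecond] using h
        cases h'
        exact .inr ⟨g, hq⟩
      · exact .inl ((Function.update_of_ne hσ _ _).symm.trans h)
    · rw [Function.update_of_ne hpq] at h
      exact .inl h
  | _ => exact .inl h

theorem hist_succ_of_not_moves {t : ℕ} {p : Fin n} (hm : ¬ τ.Moves t p) :
    hist τ (t + 1) p = hist τ t p := by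
  rcases he : τ.event t with _ | e
  · rw [(conv_stutter he).1]
  have hst := conv_step he
  have hpe : p ≠ e.proc := fun h => hm ⟨e, he, h.symm⟩
  generalize hist τ t = s, convStat τ t = st, hist τ (t + 1) = s', convStat τ (t + 1) = st' at *
  cases hst with
  | propose q g ρ w hq => exact Function.update_of_ne hpe _ _
  | vote q g ρ w b' hq => exact Function.update_of_ne hpe _ _
  | _ => rfl

/-- Round and value of a process in its loop. -/
def heldRound : Status D (ConvergeLocal D) → Option (ℕ × D)
  | .active (.propose _ ρ v) => some (ρ, v)
  | .active (.look _ ρ v) => some (ρ, v)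
  | .active (.vote _ ρ v _) => some (ρ, v)
  | .active (.check _ ρ v) => some (ρ, v)
  | _ => none

/-- The decision of a process that is about to respond or has responded. -/
def convDecision : Status D (ConvergeLocal D) → Option D
  | .active (.output v) => some v
  | .done v => some v
  | _ => none

theorem convDecision_of_respond {t : ℕ} {p : Fin n} {v : D}
    (h : τ.event t = some (.respond p v)) : convDecision (convStat τ t p) = some v := by
  have := conv_step h
  generalize hist τ t = s, convStat τ t = st, hist τ (t + 1) = s',
    convStat τ (t + 1) = st' at this ⊢
  cases this with
  | respond _ _ h' => rw [h']; rfl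

theorem conv_valid (t : ℕ) :
    (∀ p, (∀ ρ v, heldRound (convStat τ t p) = some (ρ, v) → v ∈ τ.inputs) ∧
      ∀ v, convDecision (convStat τ t p) = some v → v ∈ τ.inputs) ∧
      ∀ p ρ v b, (hist τ t p).second ρ = some (v, b) → v ∈ τ.inputs := by
  induction t with
  | zero =>
    refine ⟨fun p => ?_, fun p ρ v b => ?_⟩
    · rw [convStat_zero]; simp [heldRound, convDecision]
    · rw [hist_zero]; simp [History.empty]
  | succ t ih =>
    refine ⟨fun p => ?_, fun p ρ v b h => ?_⟩
    · refine conv_succ (Q := fun x => (∀ ρ v, heldRound x = some (ρ, v) → v ∈ τ.inputs) ∧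
        ∀ v, convDecision x = some v → v ∈ τ.inputs) (ih.1 p) fun x y _ hx hxy => ?_
      cases hxy with
      | invoke v hv => exact ⟨fun _ _ h => by cases h; exact hv, fun _ h => by cases h⟩
      | propose h ρ v =>
        exact ⟨fun _ _ h => by cases h; exact hx.1 ρ v rfl, fun _ h => by cases h⟩
      | look h ρ v =>
        exact ⟨fun _ _ h => by cases h; exact hx.1 ρ v rfl, fun _ h => by cases h⟩
      | vote h ρ v b =>
        exact ⟨fun _ _ h => by cases h; exact hx.1 ρ v rfl, fun _ h => by cases h⟩
      | decide h ρ v hs =>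
        exact ⟨fun _ _ h => (by cases h), fun _ h => by cases h; exact hx.1 ρ v rfl⟩
      | adopt h ρ v w q hq hs =>
        exact ⟨fun _ _ h => by cases h; exact ih.2 q ρ w true hq, fun _ h => by cases h⟩
      | keep h ρ v hn hs =>
        exact ⟨fun _ _ h => by cases h; exact hx.1 ρ v rfl, fun _ h => by cases h⟩
      | respond v => exact ⟨fun _ _ h => (by cases h), fun _ h => by cases h; exact hx.2 v rfl⟩
    · rcases second_succ h with h | ⟨g, h⟩
      · exact ih.2 p ρ v b h
      · exact (ih.1 p).1 ρ v (by rw [h]; rfl)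

/-! ### Agreement of the voting algorithm -/

variable (τ) in
/-- The values of votes of round `σ` with their flags set. -/
def flagged (σ : ℕ) : Set D := {w | ∃ t q, (hist τ t q).second σ = some (w, true)}

/-- The values counted for a flag include the voter's own, which was written before the scan. -/
theorem flagged_small (t : ℕ) :
    (∀ p h σ v, convStat τ t p = .active (.vote h σ v true) →
      ∃ a, (roundValues (hist τ a) σ).encard ≤ m ∧ v ∈ roundValues (hist τ a) σ) ∧
    ∀ p σ v, (hist τ t p).second σ = some (v, true) →
      ∃ a, (roundValues (hist τ a) σ).encard ≤ m ∧ v ∈ roundValues (hist τ a) σ := by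
  induction t with
  | zero =>
    refine ⟨fun p h σ v => ?_, fun p σ v => ?_⟩
    · rw [convStat_zero]; simp
    · rw [hist_zero]; simp [History.empty]
  | succ t ih =>
    refine ⟨fun p => ?_, fun p σ v h => ?_⟩
    · refine conv_succ (Q := fun x => ∀ h σ v, x = .active (.vote h σ v true) →
        ∃ a, (roundValues (hist τ a) σ).encard ≤ m ∧ v ∈ roundValues (hist τ a) σ)
        (ih.1 p) fun x y hx _ hxy => ?_
      intro h σ v hy
      subst hy
      generalize hb : true = b at hxy
      cases hxy with
      | look _ _ _ =>
        have hown := trace_ownHistory (τ := τ) t p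
        rw [hx] at hown
        exact ⟨t, of_decide_eq_true hb.symm, p, hown.2.1⟩
    · rcases second_succ h with h | ⟨g, h⟩
      · exact ih.2 p σ v h
      · exact ih.1 p g σ v h

/-- The values of a round only accumulate. Among `m + 1` flagged values, the one whose witnessing
scan is latest would have been voted for after a scan containing all of them. -/
theorem encard_flagged_le (σ : ℕ) : (flagged τ σ).encard ≤ m := by
  by_contra hlt
  have hle : ((m + 1 : ℕ) : ℕ∞) ≤ (flagged τ σ).encard := by
    rw [Nat.cast_add, Nat.cast_one]
    exact Order.add_one_le_of_lt (not_le.1 hlt)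
  obtain ⟨F, hF, hcard⟩ := Set.exists_subset_encard_eq hle
  have hfin : F.Finite := Set.finite_of_encard_eq_coe hcard
  have hall : ∀ w ∈ F, ∃ a, (roundValues (hist τ a) σ).encard ≤ m ∧
      w ∈ roundValues (hist τ a) σ := fun w hw => by
    obtain ⟨t, q, h⟩ := hF hw
    exact (flagged_small t).2 q σ w h
  have hne : F.Nonempty := by
    rw [← Set.encard_pos, hcard]
    exact_mod_cast m.succ_pos
  choose! a ha hmem using hall
  obtain ⟨w, hw, hmax⟩ := Set.exists_max_image F a hfin hne
  have hsub : F ⊆ roundValues (hist τ (a w)) σ := fun w' hw' =>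
    roundValues_mono (hmax w' hw') σ (hmem w' hw')
  have := (Set.encard_le_encard hsub).trans (ha w hw)
  rw [hcard] at this
  have h2 : m + 1 ≤ m := by exact_mod_cast this
  omega

variable (τ) in
/-- Some process can decide `w` in round `σ` at time `t`. -/
def CanDecide (σ : ℕ) (w : D) (t : ℕ) : Prop :=
  (∃ p h, convStat τ t p = .active (.check h σ w)) ∧
    ∀ q w', (hist τ t q).second σ ≠ some (w', false)

/-- A process that checks has already voted for its own value, and no vote of the round is
unflagged. -/
theorem CanDecide.exists_vote {σ t : ℕ} {w : D} (h : CanDecide τ σ w t) :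
    ∃ p, (hist τ t p).second σ = some (w, true) := by
  obtain ⟨⟨p, g, hp⟩, hall⟩ := h
  have hown := trace_ownHistory (τ := τ) t p
  rw [hp] at hown
  obtain ⟨-, ⟨b, hb⟩, -⟩ := hown
  cases b
  · exact absurd hb (hall p w)
  · exact ⟨p, hb⟩

theorem exists_decidable_of_decision (t : ℕ) (p : Fin n) :
    ∀ v, convDecision (convStat τ t p) = some v → ∃ σ a, CanDecide τ σ v a := by
  induction t with
  | zero => rw [convStat_zero]; simp [convDecision]
  | succ t ih =>
    refine conv_succ (Q := fun x => ∀ v, convDecision x = some v → ∃ σ a, CanDecide τ σ v a) ih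
      fun x y hx hQ hxy => ?_
    cases hxy with
    | decide h ρ v hs => exact fun _ h' => by cases h'; exact ⟨ρ, t, ⟨p, h, hx⟩, hs⟩
    | respond v => exact fun _ h' => by cases h'; exact hQ v rfl
    | _ => exact fun _ h' => absurd h' (by simp [convDecision])

/-- If a process can decide in round `σ`, then all who check the votes of round `σ` see a flag. -/
theorem CanDecide.exists_flag {σ t t' : ℕ} {w v : D} {g : History D} {q : Fin n}
    (h : CanDecide τ σ w t) (hq : convStat τ t' q = .active (.check g σ v)) :
    ∃ w q, (hist τ t' q).second σ = some (w, true) := by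
  rcases le_total t t' with hle | hle
  · obtain ⟨p, hp⟩ := h.exists_vote
    exact ⟨w, p, (hist_mono hle p σ).2 _ hp⟩
  · have hown := trace_ownHistory (τ := τ) t' q
    rw [hq] at hown
    obtain ⟨-, ⟨b, hb⟩, -⟩ := hown
    cases b
    · exact absurd ((hist_mono hle q σ).2 _ hb) (h.2 q v)
    · exact ⟨v, q, hb⟩

/-- After a decision in round `σ` only flagged values of this round survive. -/
theorem CanDecide.later_values {σ t₀ : ℕ} {w₀ : D} (h : CanDecide τ σ w₀ t₀) (t : ℕ) :
    (∀ p ρ v, heldRound (convStat τ t p) = some (ρ, v) → σ < ρ → v ∈ flagged τ σ) ∧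
      ∀ p ρ v b, (hist τ t p).second ρ = some (v, b) → σ < ρ → v ∈ flagged τ σ := by
  induction t with
  | zero =>
    refine ⟨fun p ρ v => ?_, fun p ρ v b => ?_⟩
    · rw [convStat_zero]; simp [heldRound]
    · rw [hist_zero]; simp [History.empty]
  | succ t ih =>
    refine ⟨fun p => ?_, fun p ρ v b h' => ?_⟩
    · refine conv_succ (Q := fun x => ∀ ρ v, heldRound x = some (ρ, v) → σ < ρ → v ∈ flagged τ σ)
        (ih.1 p) fun x y hx hQ hxy => ?_
      cases hxy with
      | invoke v hv => exact fun _ _ h' hlt => by cases h'; omega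
      | propose g ρ v => exact fun _ _ h' hlt => by cases h'; exact hQ ρ v rfl hlt
      | look g ρ v => exact fun _ _ h' hlt => by cases h'; exact hQ ρ v rfl hlt
      | vote g ρ v b => exact fun _ _ h' hlt => by cases h'; exact hQ ρ v rfl hlt
      | decide g ρ v hs => exact fun _ _ h' => by cases h'
      | adopt g ρ v w q hq hs =>
        intro _ _ h' hlt
        cases h'
        rcases (Nat.lt_succ_iff.1 hlt).eq_or_lt with rfl | hlt'
        · exact ⟨t, q, hq⟩
        · exact ih.2 q ρ w true hq hlt'
      | keep g ρ v hn hs =>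
        intro _ _ h' hlt
        cases h'
        rcases (Nat.lt_succ_iff.1 hlt).eq_or_lt with rfl | hlt'
        · exact absurd (h.exists_flag hx) hn
        · exact hQ ρ v rfl hlt'
      | respond v => exact fun _ _ h' => by cases h'
    · rcases second_succ h' with h' | ⟨g, h'⟩
      · exact ih.2 p ρ v b h'
      · exact ih.1 p ρ v (by rw [h']; rfl)

/-- Let `σ` be the least round in which a decision is possible. Decisions in `σ` are flagged values
of `σ`, and values of later rounds all descend from flagged values of `σ`; there are at most `m`. -/
theorem converge_traceSolves : (converge n m D).TraceSolves m := by
  classical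
  intro τ
  refine ⟨?_, ?_⟩
  · rintro v ⟨t, p, h⟩
    exact ((conv_valid t).1 p).2 v (convDecision_of_respond h)
  have hout : ∀ v ∈ τ.outputs, ∃ σ a, CanDecide τ σ v a := by
    rintro v ⟨t, p, h⟩
    exact exists_decidable_of_decision t p v (convDecision_of_respond h)
  by_cases hex : ∃ σ w a, CanDecide τ σ w a
  · obtain ⟨w, a, h⟩ := Nat.find_spec hex
    refine (Set.encard_le_encard fun v hv => ?_).trans (encard_flagged_le (τ := τ) (Nat.find hex))
    obtain ⟨σ, a', h'⟩ := hout v hv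
    rcases (Nat.find_min' hex ⟨v, a', h'⟩).eq_or_lt with heq | hlt
    · rw [heq]
      obtain ⟨p, hp⟩ := h'.exists_vote
      exact ⟨a', p, hp⟩
    · obtain ⟨p, g, hp⟩ := h'.1
      exact (h.later_values a').1 p σ v (by rw [hp]; rfl) hlt
  · have : τ.outputs = ∅ := by
      rw [Set.eq_empty_iff_forall_notMem]
      intro v hv
      obtain ⟨σ, a, h⟩ := hout v hv
      exact hex ⟨σ, v, a, h⟩
    simp [this]

/-! ### Termination of the voting algorithm -/

/-- Rounds beyond those that stopped processes take part in. -/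
theorem exists_round_bound (τ : (converge n m D).Trace) :
    ∃ B, ∀ q, ¬ τ.Live q → ∀ t, ∀ σ > B, (hist τ t q).first σ = none ∧
      (hist τ t q).second σ = none := by
  classical
  have : ∀ q, ∃ B, ¬ τ.Live q → ∀ t, ∀ σ > B, (hist τ t q).first σ = none ∧
      (hist τ t q).second σ = none := fun q => by
    by_cases hq : τ.Live q
    · exact ⟨0, fun h => absurd hq h⟩
    obtain ⟨T, hT⟩ := Trace.exists_forall_not_moves hq
    obtain ⟨B, hB⟩ := (trace_ownHistory (τ := τ) T q).exists_bound
    have hge : ∀ t ≥ T, hist τ t q = hist τ T q := fun t ht => by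
      induction t, ht using Nat.le_induction with
      | base => rfl
      | succ t ht ih => rw [hist_succ_of_not_moves (hT t ht), ih]
    -- Entries persist, so an entry present at any time, even before `T`, would still be there at
    -- `max t T`.
    refine ⟨B, fun _ t σ hσ => ?_⟩
    have hmax := hge (max t T) (le_max_right _ _)
    have hmono := hist_mono (τ := τ) (le_max_left t T) q σ
    rw [hmax] at hmono
    refine ⟨Option.eq_none_iff_forall_ne_some.2 fun v hv => ?_,
      Option.eq_none_iff_forall_ne_some.2 fun x hx => ?_⟩
    · have := hmono.1 v hv
      rw [(hB σ hσ).1] at this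
      cases this
    · have := hmono.2 x hx
      rw [(hB σ hσ).2] at this
      cases this
  choose B hB using this
  exact ⟨Finset.univ.sup B, fun q hq t σ hσ =>
    hB q hq t σ (lt_of_le_of_lt (Finset.le_sup (Finset.mem_univ q)) hσ)⟩

/-- In a round that stopped processes do not reach, each process contributes at most one value and
all contributors are live. -/
theorem fewValues_eq_true (hI : {p | τ.Live p}.encard ≤ m) {t σ : ℕ}
    (hB : ∀ q, ¬ τ.Live q → (hist τ t q).first σ = none) : fewValues m (hist τ t) σ = true := by
  refine decide_eq_true (le_trans ?_ hI)
  have hsub : some '' roundValues (hist τ t) σ ⊆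
      (fun q => (hist τ t q).first σ) '' {p | τ.Live p} := by
    rintro _ ⟨w, ⟨q, hq⟩, rfl⟩
    refine ⟨q, ?_, hq⟩
    by_contra hl
    rw [hB q hl] at hq
    cases hq
  rw [← (Option.some_injective D).encard_image (roundValues (hist τ t) σ)]
  exact (Set.encard_le_encard hsub).trans (Set.encard_image_le _ _)

/-- Beyond round `B` all flags are set, so that no process gets beyond round `B + 1`. -/
theorem late_rounds (hI : {p | τ.Live p}.encard ≤ m) {B : ℕ}
    (hB : ∀ q, ¬ τ.Live q → ∀ t, ∀ σ > B, (hist τ t q).first σ = none ∧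
      (hist τ t q).second σ = none) (t : ℕ) :
    (∀ p, (∀ h σ v, convStat τ t p = .active (.vote h σ v false) → σ ≤ B) ∧
      ∀ σ v, heldRound (convStat τ t p) = some (σ, v) → σ ≤ B + 1) ∧
    ∀ p σ v, (hist τ t p).second σ = some (v, false) → σ ≤ B := by
  induction t with
  | zero =>
    refine ⟨fun p => ?_, fun p σ v => ?_⟩
    · rw [convStat_zero]; simp [heldRound]
    · rw [hist_zero]; simp [History.empty]
  | succ t ih =>
    refine ⟨fun p => ?_, fun p σ v h => ?_⟩
    · refine conv_succ (Q := fun x => (∀ h σ v, x = .active (.vote h σ v false) → σ ≤ B) ∧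
        ∀ σ v, heldRound x = some (σ, v) → σ ≤ B + 1) (ih.1 p) fun x y hx hQ hxy => ?_
      -- Only an unflagged vote sends a process to the next round, and such votes do not occur
      -- beyond round `B`.
      have hround : ∀ σ, (¬ ∀ q w, (hist τ t q).second σ ≠ some (w, false)) → σ ≤ B := by
        intro σ hσ
        push Not at hσ
        obtain ⟨q, w, hq⟩ := hσ
        exact ih.2 q σ w hq
      cases hxy with
      | invoke v hv =>
        exact ⟨fun _ _ _ h' => (by cases h'), fun _ _ h' => by cases h'; omega⟩
      | propose g ρ v =>
        exact ⟨fun _ _ _ h' => (by cases h'), fun _ _ h' => by cases h'; exact hQ.2 ρ v rfl⟩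
      | look g ρ v =>
        refine ⟨fun h σ v' h' => ?_, fun _ _ h' => by cases h'; exact hQ.2 ρ v rfl⟩
        injection h' with h'
        injection h' with h1 h2 h3 h4
        subst h2
        by_contra hlt
        rw [fewValues_eq_true hI fun q hq => (hB q hq t _ (not_le.1 hlt)).1] at h4
        cases h4
      | vote g ρ v b =>
        exact ⟨fun _ _ _ h' => (by cases h'), fun _ _ h' => by cases h'; exact hQ.2 ρ v rfl⟩
      | decide g ρ v hs => exact ⟨fun _ _ _ h' => (by cases h'), fun _ _ h' => by cases h'⟩
      | adopt g ρ v w q hq hs =>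
        exact ⟨fun _ _ _ h' => (by cases h'),
          fun _ _ h' => by cases h'; exact Nat.succ_le_succ (hround ρ hs)⟩
      | keep g ρ v hn hs =>
        exact ⟨fun _ _ _ h' => (by cases h'),
          fun _ _ h' => by cases h'; exact Nat.succ_le_succ (hround ρ hs)⟩
      | respond v => exact ⟨fun _ _ _ h' => (by cases h'), fun _ _ h' => by cases h'⟩
    · rcases second_succ h with h | ⟨g, h⟩
      · exact ih.2 p σ v h
      · exact (ih.1 p).1 g σ v h

/-- The number of steps a process may still take if it stays within round `B + 1`. -/
def convRank (B : ℕ) : Status D (ConvergeLocal D) → ℕ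
  | .ready => 4 * B + 12
  | .active (.propose _ ρ _) => 4 * B + 11 - 4 * ρ
  | .active (.look _ ρ _) => 4 * B + 10 - 4 * ρ
  | .active (.vote _ ρ _ _) => 4 * B + 9 - 4 * ρ
  | .active (.check _ ρ _) => 4 * B + 8 - 4 * ρ
  | .active (.output _) => 1
  | .done _ => 0

/-- A round takes four steps and no process gets beyond round `B + 1`, so `convRank` decreases with
every step. -/
theorem converge_traceTerminates : (converge n m D).TraceTerminates m := by
  intro τ hI p
  obtain ⟨B, hB⟩ := exists_round_bound τ
  have hlt : ∀ t ≥ 0, τ.Moves t p →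
      convRank B (convStat τ (t + 1) p) < convRank B (convStat τ t p) := by
    intro t _ hm
    have hround := ((late_rounds hI hB t).1 p).2
    have hmove := conv_move hm
    generalize convStat τ t p = x, convStat τ (t + 1) p = y at *
    cases hmove with
    | invoke v hv => simp [convRank]
    | propose g ρ v => have := hround ρ v rfl; simp only [convRank]; omega
    | look g ρ v => have := hround ρ v rfl; simp only [convRank]; omega
    | vote g ρ v b => have := hround ρ v rfl; simp only [convRank]; omega
    | decide g ρ v hs => have := hround ρ v rfl; simp only [convRank]; omega
    | adopt g ρ v w q hq hs => have := hround ρ v rfl; simp only [convRank]; omega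
    | keep g ρ v hn hs => have := hround ρ v rfl; simp only [convRank]; omega
    | respond v => simp [convRank]
  refine Trace.not_live_of_rank (fun t => convRank B (convStat τ t p)) 0 (fun t ht => ?_) hlt
  by_cases hm : τ.Moves t p
  · exact (hlt t ht hm).le
  · exact (congrArg (convRank B) (Trace.status_succ_of_not_moves hm)).le

end Converge

end SetAgreement

/-! ### Assembly -/

theorem theorem2 {n m k : ℕ} (hm : 1 ≤ m) (hmk : m ≤ k) (hkn : k < n) (D : Type u) :
    ((SetAgreement.twoCopies n m (n + 2 * m - k)
        (SetAgreement.components_pos m hkn) D).SolvesSetAgreement k ∧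
      (SetAgreement.twoCopies n m (n + 2 * m - k)
        (SetAgreement.components_pos m hkn) D).ObstructionFree m) ∧
    ∃ (V : Type u)
      (A : SetAgreement.Algorithm (SetAgreement.registers (min (n + 2 * m - k) n) V) n D),
      A.SolvesSetAgreement k ∧ A.ObstructionFree m := by
  have hs := SetAgreement.twoCopies_traceSolves (n := n) (m := m)
    (hr := SetAgreement.components_pos m hkn) (D := D) hmk (by omega)
  have ht := SetAgreement.twoCopies_traceTerminates (n := n) (m := m)
    (hr := SetAgreement.components_pos m hkn) (D := D) (by omega)
  refine ⟨⟨hs.solvesSetAgreement, ht.obstructionFree⟩, ?_⟩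
  -- With more than `n` components the two-copies algorithm would need too many registers;
  -- `converge` needs `n`, and its `m`-agreement suffices since `m ≤ k`.
  rcases le_total (n + 2 * m - k) n with hle | hle
  · rw [min_eq_left hle]
    exact ⟨_, SetAgreement.simulate _,
      (hs.simulate (SetAgreement.components_pos m hkn)).solvesSetAgreement,
      (ht.simulate (SetAgreement.components_pos m hkn)).obstructionFree⟩
  · rw [min_eq_right hle]
    have hn : 0 < n := by omega
    refine ⟨_, SetAgreement.simulate (SetAgreement.converge n m D), ?_,
      (SetAgreement.converge_traceTerminates.simulate hn).obstructionFree⟩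
    exact fun α => ⟨((SetAgreement.converge_traceSolves.simulate hn).solvesSetAgreement α).1,
      ((SetAgreement.converge_traceSolves.simulate hn).solvesSetAgreement α).2.trans
        (by exact_mod_cast hmk)⟩
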